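/- Let $d\ge 1$. Let $\Gamma_0$ be the space of finite subsets of $\mathbb R^d$, let $\lambda=\sum_{n\ge0}\frac1{n!}m^{(n)}$ be the Lebesgue--Poisson measure on it ($m^{(n)}$ being the image of $dx_1\cdots dx_n$ under $(x_1,\dots,x_n)\mapsto\{x_1,\dots,x_n\}$), let $\Gamma_0^2=\{(\eta^+,\eta^-)\in\Gamma_0\times\Gamma_0:\eta^+\cap\eta^-=\emptyset\}$, $\lambda^2=\lambda\otimes\lambda$ on $\Gamma_0^2$, and, for a bounded Borel set $\Lambda\subset\mathbb R^d$ and $n,m\in\mathbb N_0$, let $\Gamma_\Lambda^{(n,m)}=\{(\eta^+,\eta^-)\in\Gamma_0^2:\eta^\pm\subset\Lambda,\ |\eta^+|=n,\ |\eta^-|=m\}$. Let $B_{bs}(\Gamma_0^2)$ be the set of bounded measurable $G:\Gamma_0^2\to\mathbb R$ that vanish outside some $\bigcup_{n\le N^+,\,m\le N^-}\{\eta^\pm\subset\Lambda^\pm,\ |\eta^+|=n,\ |\eta^-|=m\}$ with $\Lambda^\pm$ bounded Borel. Put $$(\mathcal KG)(\eta^+,\eta^-)=\sum_{\xi^\pm\subset\eta^\pm}G(\xi^+,\xi^-),\qquad(\mathcal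 K^{-1}F)(\eta^+,\eta^-)=\sum_{\xi^\pm\subset\eta^\pm}(-1)^{|\eta^+\setminus\xi^+|+|\eta^-\setminus\xi^-|}F(\xi^+,\xi^-).$$ For $i=1,2$ let $c_i^\pm(x,y,\eta^+,\eta^-)\ge0$ be measurable on $\mathbb R^d\times\mathbb R^d\times\Gamma_0^2$ and locally integrable in $(x,y)$ for every $(\eta^+,\eta^-)$. Writing $x$ for $\{x\}$, let $$\begin{aligned}(L_1F)(\gamma^+,\gamma^-)=&\sum_{x\in\gamma^+}\int_{\mathbb R^d}dx'\,c_1^+(x,x',\gamma^+\setminus x,\gamma^-)\bigl(F(\gamma^+\setminus x\cup x',\gamma^-)-F(\gamma^+,\gamma^-)\bigr)\\&+\sum_{y\in\gamma^-}\int_{\mathbb R^d}dy'\,c_1^-(y,y',\gamma^+,\gamma^-\setminus y)\bigl(F(\gamma^+,\gamma^-\setminus y\cup y')-F(\gamma^+,\gamma^-)\bigr),\\(L_2F)(\gamma^+,\gamma^-)=&\sum_{x\in\gamma^+}\int_{\mathbb R^d}dy\,c_2^+(x,y,\gamma^+\setminus x,\gamma^-)\bigl(F(\gamma^+\setminus x,\gamma^-\cup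 y)-F(\gamma^+,\gamma^-)\bigr)\\&+\sum_{y\in\gamma^-}\int_{\mathbb R^d}dx\,c_2^-(x,y,\gamma^+,\gamma^-\setminus y)\bigl(F(\gamma^+\cup x,\gamma^-\setminus y)-F(\gamma^+,\gamma^-)\bigr),\end{aligned}$$ $\hat L_i=\mathcal K^{-1}L_i\mathcal K$ and $C_i^\pm(x,y,\xi^+,\xi^-,\eta^+,\eta^-)=\bigl(\mathcal K^{-1}c_i^\pm(x,y,\cdot\cup\xi^+,\cdot\cup\xi^-)\bigr)(\eta^+,\eta^-)$. For $k\in B_{bs}(\Gamma_0^2)$, a function $h$ on $\Gamma_0^2$ is called a version of $\hat L_i^*k$ if for all $G\in B_{bs}(\Gamma_0^2)$ the functions $(\hat L_iG)\,k$ and $G\,h$ are $\lambda^2$-integrable and $\int_{\Gamma_0^2}(\hat L_iG)\,k\,d\lambda^2=\int_{\Gamma_0^2}G\,h\,d\lambda^2$. Assume that for all bounded Borel sets $\Lambda\subset\mathbb R^d$ and all $n,m\in\mathbb N_0$ the total jump rates are integrable over $\Gamma_\Lambda^{(n,m)}$, i.e. $$\begin{aligned}&\int_{\Gamma_\Lambda^{(n,m)}}d\lambda^2(\eta^+,\eta^-)\Bigl(\sum_{x\in\eta^+}\int_{\mathbb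 R^d}dx'\,c_1^+(x,x',\eta^+\setminus x,\eta^-)+\sum_{y\in\eta^-}\int_{\mathbb R^d}dy'\,c_1^-(y,y',\eta^+,\eta^-\setminus y)\Bigr)<\infty,\\&\int_{\Gamma_\Lambda^{(n,m)}}d\lambda^2(\eta^+,\eta^-)\Bigl(\sum_{x\in\eta^+}\int_{\mathbb R^d}dy\,c_2^+(x,y,\eta^+\setminus x,\eta^-)+\sum_{y\in\eta^-}\int_{\mathbb R^d}dx\,c_2^-(x,y,\eta^+,\eta^-\setminus y)\Bigr)<\infty,\end{aligned}$$ and that $$\begin{aligned}&\int_{\Gamma^{(n,m)}_\Lambda}d\lambda^2(\eta^+,\eta^-)\int_\Lambda dx'\sum_{\xi^\pm\subset\eta^\pm}\Bigl(\sum_{x\in\xi^+}\bigl|C_1^+(x,x',\xi^+\setminus x,\xi^-,\eta^+\setminus\xi^+,\eta^-\setminus\xi^-)\bigr|\\&\qquad\qquad+\sum_{y\in\xi^-}\bigl|C_1^-(y,x',\xi^+,\xi^-\setminus y,\eta^+\setminus\xi^+,\eta^-\setminus\xi^-)\bigr|\Bigr)<\infty,\\&\int_{\Gamma^{(n,m)}_\Lambda}d\lambda^2(\eta^+,\eta^-)\int_\Lambda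 dx'\sum_{\xi^\pm\subset\eta^\pm}\Bigl(\sum_{x\in\xi^+}\bigl|C_2^+(x,x',\xi^+\setminus x,\xi^-,\eta^+\setminus\xi^+,\eta^-\setminus\xi^-)\bigr|\\&\qquad\qquad+\sum_{y\in\xi^-}\bigl|C_2^-(x',y,\xi^+,\xi^-\setminus y,\eta^+\setminus\xi^+,\eta^-\setminus\xi^-)\bigr|\Bigr)<\infty.\end{aligned}$$ Then for each $k\in B_{bs}(\Gamma_0^2)$ the function $\hat L_i^*k$, $i=1,2$, exists and is unique up to $\lambda^2$-null sets, and for $\lambda^2$-a.a. $(\eta^+,\eta^-)\in\Gamma_0^2$ it is given by the following formulas, in which all integrals converge absolutely: $$\begin{aligned}(\hat L_1^*k)(\eta^+,\eta^-)=&\sum_{x\in\eta^+}\int_{\Gamma_0^2}d\lambda^2(\xi^+,\xi^-)\int_{\mathbb R^d}dx'\,k(\xi^+\cup\eta^+\cup x'\setminus x,\xi^-\cup\eta^-)\,C_1^+(x',x,\eta^+\setminus x,\eta^-,\xi^+,\xi^-)\\&-\sum_{x\in\eta^+}\int_{\Gamma_0^2}d\lambda^2(\xi^+,\xi^-)\,k(\xi^+\cup\eta^+,\xi^-\cup\eta^-)\int_{\mathbb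 R^d}dx'\,C_1^+(x,x',\eta^+\setminus x,\eta^-,\xi^+,\xi^-)\\&+\sum_{y\in\eta^-}\int_{\Gamma_0^2}d\lambda^2(\xi^+,\xi^-)\int_{\mathbb R^d}dy'\,k(\xi^+\cup\eta^+,\xi^-\cup\eta^-\cup y'\setminus y)\,C_1^-(y',y,\eta^+,\eta^-\setminus y,\xi^+,\xi^-)\\&-\sum_{y\in\eta^-}\int_{\Gamma_0^2}d\lambda^2(\xi^+,\xi^-)\,k(\xi^+\cup\eta^+,\xi^-\cup\eta^-)\int_{\mathbb R^d}dy'\,C_1^-(y,y',\eta^+,\eta^-\setminus y,\xi^+,\xi^-)\end{aligned}$$ and $$\begin{aligned}(\hat L_2^*k)(\eta^+,\eta^-)=&\sum_{y\in\eta^-}\int_{\Gamma_0^2}d\lambda^2(\xi^+,\xi^-)\int_{\mathbb R^d}dx\,k(\xi^+\cup\eta^+\cup x,\xi^-\cup\eta^-\setminus y)\,C_2^+(x,y,\eta^+,\eta^-\setminus y,\xi^+,\xi^-)\\&-\sum_{x\in\eta^+}\int_{\Gamma_0^2}d\lambda^2(\xi^+,\xi^-)\,k(\xi^+\cup\eta^+,\xi^-\cup\eta^-)\int_{\mathbb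 R^d}dy\,C_2^+(x,y,\eta^+\setminus x,\eta^-,\xi^+,\xi^-)\\&+\sum_{x\in\eta^+}\int_{\Gamma_0^2}d\lambda^2(\xi^+,\xi^-)\int_{\mathbb R^d}dy\,k(\xi^+\cup\eta^+\setminus x,\xi^-\cup\eta^-\cup y)\,C_2^-(x,y,\eta^+\setminus x,\eta^-,\xi^+,\xi^-)\\&-\sum_{y\in\eta^-}\int_{\Gamma_0^2}d\lambda^2(\xi^+,\xi^-)\int_{\mathbb R^d}dx\,k(\xi^+\cup\eta^+,\xi^-\cup\eta^-)\,C_2^-(x,y,\eta^+,\eta^-\setminus y,\xi^+,\xi^-).\end{aligned}$$ -/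

import Mathlib

open MeasureTheory
open scoped Nat ENNReal

noncomputable section

namespace TwoComp

/-- The position space `ℝ^d`. -/
abbrev E (d : ℕ) : Type := EuclideanSpace ℝ (Fin d)

/-- The space `Γ₀` of finite configurations, that is, finite subsets of `ℝ^d`.  (A structure and
not `Finset (E d)` itself, whose σ-algebra in Mathlib is not the one used here.) -/
@[ext]
structure Conf (d : ℕ) : Type where
  pts : Finset (E d)

/-- The `n`-tuples of pairwise distinct points of `ℝ^d`. -/
abbrev Tuple (d n : ℕ) : Type := {x : Fin n → E d // Function.Injective x}

/-- The map `(x₁, …, xₙ) ↦ {x₁, …, xₙ}` from tuples of distinct points onto `Γ^(n)`. -/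
def toConf (d n : ℕ) (x : Tuple d n) : Conf d := ⟨Finset.univ.image x.1⟩

/-- The Borel σ-algebra of `Γ₀ = ⨆ₙ Γ^(n)` (disjoint union), where `Γ^(n)` is the quotient of the
space of `n`-tuples of distinct points by permutations: a set is measurable iff its preimage in
each space of tuples is Borel.  (As `toConf d n` is the quotient map by a free action of a finite
group, the Borel sets of the quotient topology are exactly the sets with Borel preimage.) -/
instance instMeasurableSpaceConf (d : ℕ) : MeasurableSpace (Conf d) :=
  ⨅ n : ℕ, MeasurableSpace.map (toConf d n) inferInstance

/-- The Lebesgue–Poisson measure `λ = ∑ₙ m^(n) / n!` on `Γ₀`, where `m^(n)` is the image of the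
Lebesgue measure `dx₁ … dxₙ` on the tuples of distinct points. -/
def lebPoisson (d : ℕ) : Measure (Conf d) :=
  Measure.sum fun n : ℕ => ((n ! : ℝ≥0∞)⁻¹) •
    ((volume : Measure (Fin n → E d)).comap (Subtype.val : Tuple d n → Fin n → E d)).map
      (toConf d n)

theorem measurableSet_conf {d : ℕ} {S : Set (Conf d)} :
    MeasurableSet S ↔ ∀ n, MeasurableSet (toConf d n ⁻¹' S) := by
  simp only [MeasurableSpace.measurableSet_iInf]; rfl

theorem measurableSet_subset {d : ℕ} {U : Set (E d)} (hU : MeasurableSet U) :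
    MeasurableSet {A : Conf d | (A.pts : Set (E d)) ⊆ U} := by
  rw [measurableSet_conf]
  intro n
  have : toConf d n ⁻¹' {A : Conf d | (A.pts : Set (E d)) ⊆ U} =
      ⋂ i : Fin n, {x : Tuple d n | x.1 i ∈ U} := by
    ext x
    simp [toConf, Set.subset_def]
  rw [this]
  exact MeasurableSet.iInter fun i => ((measurable_pi_apply i).comp measurable_subtype_coe) hU

/-- The set of disjoint pairs is measurable, so that restricting `λ ⊗ λ` to it is meaningful. -/
theorem measurableSet_disjoint (d : ℕ) :
    MeasurableSet {p : Conf d × Conf d | Disjoint p.1.pts p.2.pts} := by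
  have key : {p : Conf d × Conf d | Disjoint p.1.pts p.2.pts} =
      ⋃ s ∈ {s : Set (Set (E d)) | s.Finite ∧ s ⊆ TopologicalSpace.countableBasis (E d)},
        ({A : Conf d | (A.pts : Set (E d)) ⊆ ⋃₀ s} ×ˢ
          {B : Conf d | (B.pts : Set (E d)) ⊆ (⋃₀ s)ᶜ}) := by
    ext ⟨A, B⟩
    simp only [Set.mem_ofPred_eq, Set.mem_iUnion, Set.mem_prod, exists_prop]
    constructor
    · intro h
      have hb : IsOpen ((B.pts : Set (E d))ᶜ) := B.pts.finite_toSet.isClosed.isOpen_compl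
      have : ∀ a ∈ A.pts, ∃ v ∈ TopologicalSpace.countableBasis (E d),
          a ∈ v ∧ v ⊆ (B.pts : Set (E d))ᶜ := fun a ha =>
        (TopologicalSpace.isBasis_countableBasis (E d)).exists_subset_of_mem_open
          (by simpa using Finset.disjoint_left.1 h ha) hb
      choose! v hv using this
      refine ⟨v '' A.pts, ⟨A.pts.finite_toSet.image v, ?_⟩, ?_, ?_⟩
      · rintro _ ⟨a, ha, rfl⟩
        exact (hv a ha).1
      · intro a ha
        exact ⟨v a, ⟨a, ha, rfl⟩, (hv a ha).2.1⟩
      · rintro b hb ⟨_, ⟨a, ha, rfl⟩, hba⟩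
        exact (hv a ha).2.2 hba hb
    · rintro ⟨s, -, h1, h2⟩
      exact Finset.disjoint_left.2 fun a ha hb => h2 hb (h1 ha)
  rw [key]
  refine MeasurableSet.biUnion
    (Set.countable_ofPred_finite_subset (TopologicalSpace.countable_countableBasis _)) ?_
  rintro s ⟨hs, hsb⟩
  have ho : MeasurableSet (⋃₀ s) :=
    (isOpen_sUnion fun u hu => TopologicalSpace.isOpen_of_mem_countableBasis (hsb hu)).measurableSet
  exact (measurableSet_subset ho).prod (measurableSet_subset ho.compl)

/-- The space `Γ₀²` of pairs of disjoint finite configurations, with the trace of the product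
σ-algebra. -/
abbrev Conf2 (d : ℕ) : Type := {p : Conf d × Conf d // Disjoint p.1.pts p.2.pts}

variable {d : ℕ}

/-- The configuration `η⁺`. -/
abbrev Conf2.pos (η : Conf2 d) : Finset (E d) := η.1.1.pts

/-- The configuration `η⁻`. -/
abbrev Conf2.neg (η : Conf2 d) : Finset (E d) := η.1.2.pts

/-- The measure `λ² = λ ⊗ λ` on `Γ₀²`. -/
def lebPoisson2 (d : ℕ) : Measure (Conf2 d) :=
  ((lebPoisson d).prod (lebPoisson d)).comap Subtype.val

/-- The value `F(A, B)` of a function on `Γ₀²`.  If `A` and `B` are not disjoint it is set to `0`;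
in the formulas below this concerns only a null set of arguments. -/
def ev (F : Conf2 d → ℝ) (A B : Finset (E d)) : ℝ :=
  if h : Disjoint A B then F ⟨(⟨A⟩, ⟨B⟩), h⟩ else 0

/-- The set `Γ_Λ^(n,m)` of those `(η⁺, η⁻) ∈ Γ₀²` with `η⁺, η⁻ ⊆ Λ`, `|η⁺| = n`, `|η⁻| = m`. -/
def confIn (Λ : Set (E d)) (n m : ℕ) : Set (Conf2 d) :=
  {η | (η.pos : Set (E d)) ⊆ Λ ∧ (η.neg : Set (E d)) ⊆ Λ ∧ η.pos.card = n ∧ η.neg.card = m}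

/-- The class `B_bs(Γ₀²)` of bounded measurable functions with bounded support. -/
structure IsBbs (G : Conf2 d → ℝ) : Prop where
  measurable : Measurable G
  bounded : ∃ M : ℝ, ∀ η, |G η| ≤ M
  support : ∃ (Λp Λm : Set (E d)) (Np Nm : ℕ),
    MeasurableSet Λp ∧ Bornology.IsBounded Λp ∧ MeasurableSet Λm ∧ Bornology.IsBounded Λm ∧
    ∀ η : Conf2 d, G η ≠ 0 → (η.pos : Set (E d)) ⊆ Λp ∧ η.pos.card ≤ Np ∧
      (η.neg : Set (E d)) ⊆ Λm ∧ η.neg.card ≤ Nm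

/-- The `K`-transform, on `Γ₀²`. -/
def KT (G : Conf2 d → ℝ) (η : Conf2 d) : ℝ :=
  ∑ A ∈ η.pos.powerset, ∑ B ∈ η.neg.powerset, ev G A B

/-- The inverse `K`-transform. -/
def KInv (F : Conf2 d → ℝ) (η : Conf2 d) : ℝ :=
  ∑ A ∈ η.pos.powerset, ∑ B ∈ η.neg.powerset,
    (-1 : ℝ) ^ ((η.pos \ A).card + (η.neg \ B).card) * ev F A B

/-- Standing assumptions on a hopping rate `c(x, y, η⁺, η⁻)`: nonnegative, measurable, and locally
integrable in `(x, y)` for each configuration. -/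
structure IsRate (c : E d → E d → Conf2 d → ℝ) : Prop where
  measurable : Measurable fun p : E d × E d × Conf2 d => c p.1 p.2.1 p.2.2
  nonneg : ∀ x y η, 0 ≤ c x y η
  locInt : ∀ η, LocallyIntegrable (fun p : E d × E d => c p.1 p.2 η) volume

/-- The function `C(x, y, ξ⁺, ξ⁻, η⁺, η⁻) = (K⁻¹ c(x, y, · ∪ ξ⁺, · ∪ ξ⁻))(η⁺, η⁻)`. -/
def KRate (c : E d → E d → Conf2 d → ℝ) (x y : E d) (ξp ξm ηp ηm : Finset (E d)) : ℝ :=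
  ev (KInv fun ζ => ev (c x y) (ζ.pos ∪ ξp) (ζ.neg ∪ ξm)) ηp ηm

/-- The generator `L₁` of hopping with preservation of the mark, on functions on `Γ₀²`. -/
def L1 (cp cm : E d → E d → Conf2 d → ℝ) (F : Conf2 d → ℝ) (γ : Conf2 d) : ℝ :=
  (∑ x ∈ γ.pos, ∫ x' : E d, ev (cp x x') (γ.pos \ {x}) γ.neg *
      (ev F ((γ.pos \ {x}) ∪ {x'}) γ.neg - F γ)) +
  ∑ y ∈ γ.neg, ∫ y' : E d, ev (cm y y') γ.pos (γ.neg \ {y}) *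
      (ev F γ.pos ((γ.neg \ {y}) ∪ {y'}) - F γ)

/-- The generator `L₂` of hopping with change of the mark, on functions on `Γ₀²`.  In `c₂⁻(x, y)`
the hop goes from `y` to `x`. -/
def L2 (cp cm : E d → E d → Conf2 d → ℝ) (F : Conf2 d → ℝ) (γ : Conf2 d) : ℝ :=
  (∑ x ∈ γ.pos, ∫ y : E d, ev (cp x y) (γ.pos \ {x}) γ.neg *
      (ev F (γ.pos \ {x}) (γ.neg ∪ {y}) - F γ)) +
  ∑ y ∈ γ.neg, ∫ x : E d, ev (cm x y) γ.pos (γ.neg \ {y}) *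
      (ev F (γ.pos ∪ {x}) (γ.neg \ {y}) - F γ)

/-- `L̂₁ = K⁻¹ L₁ K`. -/
def LHat1 (cp cm : E d → E d → Conf2 d → ℝ) (G : Conf2 d → ℝ) : Conf2 d → ℝ :=
  KInv (L1 cp cm (KT G))

/-- `L̂₂ = K⁻¹ L₂ K`. -/
def LHat2 (cp cm : E d → E d → Conf2 d → ℝ) (G : Conf2 d → ℝ) : Conf2 d → ℝ :=
  KInv (L2 cp cm (KT G))

/-- `h` is the image `T* k` of `k` under the dual of an operator `T` on `B_bs(Γ₀²)`, with respect to
the pairing `⟨⟨G, k⟩⟩ = ∫ G k dλ²`: both pairings converge and agree for all `G ∈ B_bs(Γ₀²)`. -/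
def IsDualImage (T : (Conf2 d → ℝ) → Conf2 d → ℝ) (k h : Conf2 d → ℝ) : Prop :=
  ∀ G : Conf2 d → ℝ, IsBbs G →
    Integrable (fun η => T G η * k η) (lebPoisson2 d) ∧
    Integrable (fun η => G η * h η) (lebPoisson2 d) ∧
    ∫ η, T G η * k η ∂(lebPoisson2 d) = ∫ η, G η * h η ∂(lebPoisson2 d)

/-- The constant `C_{1,Λ,m,n}`. -/
def bound1 (cp cm : E d → E d → Conf2 d → ℝ) (Λ : Set (E d)) (m n : ℕ) : ℝ≥0∞ :=
  ∫⁻ η in confIn Λ n m, ∫⁻ x' in Λ,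
    ∑ ξp ∈ η.pos.powerset, ∑ ξm ∈ η.neg.powerset,
      ((∑ x ∈ ξp, ENNReal.ofReal
          |KRate cp x x' (ξp \ {x}) ξm (η.pos \ ξp) (η.neg \ ξm)|) +
       ∑ y ∈ ξm, ENNReal.ofReal
          |KRate cm y x' ξp (ξm \ {y}) (η.pos \ ξp) (η.neg \ ξm)|) ∂volume ∂(lebPoisson2 d)

/-- The constant `C_{2,Λ,m,n}`. -/
def bound2 (cp cm : E d → E d → Conf2 d → ℝ) (Λ : Set (E d)) (m n : ℕ) : ℝ≥0∞ :=
  ∫⁻ η in confIn Λ n m, ∫⁻ x' in Λ,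
    ∑ ξp ∈ η.pos.powerset, ∑ ξm ∈ η.neg.powerset,
      ((∑ x ∈ ξp, ENNReal.ofReal
          |KRate cp x x' (ξp \ {x}) ξm (η.pos \ ξp) (η.neg \ ξm)|) +
       ∑ y ∈ ξm, ENNReal.ofReal
          |KRate cm x' y ξp (ξm \ {y}) (η.pos \ ξp) (η.neg \ ξm)|) ∂volume ∂(lebPoisson2 d)

/-- The integral over `Γ_Λ^(n,m)` of the total rate at which `L₁` makes a configuration jump. -/
def totalRate1 (cp cm : E d → E d → Conf2 d → ℝ) (Λ : Set (E d)) (m n : ℕ) : ℝ≥0∞ :=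
  ∫⁻ η in confIn Λ n m,
    ((∑ x ∈ η.pos, ∫⁻ x' : E d, ENNReal.ofReal (ev (cp x x') (η.pos \ {x}) η.neg)) +
     ∑ y ∈ η.neg, ∫⁻ y' : E d, ENNReal.ofReal (ev (cm y y') η.pos (η.neg \ {y})))
    ∂(lebPoisson2 d)

/-- The integral over `Γ_Λ^(n,m)` of the total rate at which `L₂` makes a configuration jump. -/
def totalRate2 (cp cm : E d → E d → Conf2 d → ℝ) (Λ : Set (E d)) (m n : ℕ) : ℝ≥0∞ :=
  ∫⁻ η in confIn Λ n m,
    ((∑ x ∈ η.pos, ∫⁻ y : E d, ENNReal.ofReal (ev (cp x y) (η.pos \ {x}) η.neg)) +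
     ∑ y ∈ η.neg, ∫⁻ x : E d, ENNReal.ofReal (ev (cm x y) η.pos (η.neg \ {y})))
    ∂(lebPoisson2 d)

/-- The explicit expression for `L̂₁* k`. -/
def dualFormula1 (cp cm : E d → E d → Conf2 d → ℝ) (k : Conf2 d → ℝ) (η : Conf2 d) : ℝ :=
  (∑ x ∈ η.pos, ∫ ξ, ∫ x' : E d,
      ev k ((ξ.pos ∪ η.pos ∪ {x'}) \ {x}) (ξ.neg ∪ η.neg) *
        KRate cp x' x (η.pos \ {x}) η.neg ξ.pos ξ.neg ∂volume ∂(lebPoisson2 d)) -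
  (∑ x ∈ η.pos, ∫ ξ, ev k (ξ.pos ∪ η.pos) (ξ.neg ∪ η.neg) *
      ∫ x' : E d, KRate cp x x' (η.pos \ {x}) η.neg ξ.pos ξ.neg ∂volume ∂(lebPoisson2 d)) +
  (∑ y ∈ η.neg, ∫ ξ, ∫ y' : E d,
      ev k (ξ.pos ∪ η.pos) ((ξ.neg ∪ η.neg ∪ {y'}) \ {y}) *
        KRate cm y' y η.pos (η.neg \ {y}) ξ.pos ξ.neg ∂volume ∂(lebPoisson2 d)) -
  ∑ y ∈ η.neg, ∫ ξ, ev k (ξ.pos ∪ η.pos) (ξ.neg ∪ η.neg) *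
      ∫ y' : E d, KRate cm y y' η.pos (η.neg \ {y}) ξ.pos ξ.neg ∂volume ∂(lebPoisson2 d)

/-- The explicit expression for `L̂₂* k`. -/
def dualFormula2 (cp cm : E d → E d → Conf2 d → ℝ) (k : Conf2 d → ℝ) (η : Conf2 d) : ℝ :=
  (∑ y ∈ η.neg, ∫ ξ, ∫ x : E d,
      ev k (ξ.pos ∪ η.pos ∪ {x}) ((ξ.neg ∪ η.neg) \ {y}) *
        KRate cp x y η.pos (η.neg \ {y}) ξ.pos ξ.neg ∂volume ∂(lebPoisson2 d)) -
  (∑ x ∈ η.pos, ∫ ξ, ev k (ξ.pos ∪ η.pos) (ξ.neg ∪ η.neg) *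
      ∫ y : E d, KRate cp x y (η.pos \ {x}) η.neg ξ.pos ξ.neg ∂volume ∂(lebPoisson2 d)) +
  (∑ x ∈ η.pos, ∫ ξ, ∫ y : E d,
      ev k ((ξ.pos ∪ η.pos) \ {x}) (ξ.neg ∪ η.neg ∪ {y}) *
        KRate cm x y (η.pos \ {x}) η.neg ξ.pos ξ.neg ∂volume ∂(lebPoisson2 d)) -
  ∑ y ∈ η.neg, ∫ ξ, ∫ x : E d, ev k (ξ.pos ∪ η.pos) (ξ.neg ∪ η.neg) *
      KRate cm x y η.pos (η.neg \ {y}) ξ.pos ξ.neg ∂volume ∂(lebPoisson2 d)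

/-- All integrals in the expression for `(L̂₁* k)(η)` converge absolutely. -/
def Converges1 (cp cm : E d → E d → Conf2 d → ℝ) (k : Conf2 d → ℝ) (η : Conf2 d) : Prop :=
  (∀ x ∈ η.pos,
    Integrable (fun q : Conf2 d × E d =>
      ev k ((q.1.pos ∪ η.pos ∪ {q.2}) \ {x}) (q.1.neg ∪ η.neg) *
        KRate cp q.2 x (η.pos \ {x}) η.neg q.1.pos q.1.neg) ((lebPoisson2 d).prod volume) ∧
    Integrable (fun q : Conf2 d × E d =>
      ev k (q.1.pos ∪ η.pos) (q.1.neg ∪ η.neg) *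
        KRate cp x q.2 (η.pos \ {x}) η.neg q.1.pos q.1.neg) ((lebPoisson2 d).prod volume)) ∧
  (∀ y ∈ η.neg,
    Integrable (fun q : Conf2 d × E d =>
      ev k (q.1.pos ∪ η.pos) ((q.1.neg ∪ η.neg ∪ {q.2}) \ {y}) *
        KRate cm q.2 y η.pos (η.neg \ {y}) q.1.pos q.1.neg) ((lebPoisson2 d).prod volume) ∧
    Integrable (fun q : Conf2 d × E d =>
      ev k (q.1.pos ∪ η.pos) (q.1.neg ∪ η.neg) *
        KRate cm y q.2 η.pos (η.neg \ {y}) q.1.pos q.1.neg) ((lebPoisson2 d).prod volume))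

/-- All integrals in the expression for `(L̂₂* k)(η)` converge absolutely. -/
def Converges2 (cp cm : E d → E d → Conf2 d → ℝ) (k : Conf2 d → ℝ) (η : Conf2 d) : Prop :=
  (∀ y ∈ η.neg,
    Integrable (fun q : Conf2 d × E d =>
      ev k (q.1.pos ∪ η.pos ∪ {q.2}) ((q.1.neg ∪ η.neg) \ {y}) *
        KRate cp q.2 y η.pos (η.neg \ {y}) q.1.pos q.1.neg) ((lebPoisson2 d).prod volume) ∧
    Integrable (fun q : Conf2 d × E d =>
      ev k (q.1.pos ∪ η.pos) (q.1.neg ∪ η.neg) *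
        KRate cm q.2 y η.pos (η.neg \ {y}) q.1.pos q.1.neg) ((lebPoisson2 d).prod volume)) ∧
  (∀ x ∈ η.pos,
    Integrable (fun q : Conf2 d × E d =>
      ev k ((q.1.pos ∪ η.pos) \ {x}) (q.1.neg ∪ η.neg ∪ {q.2}) *
        KRate cm x q.2 (η.pos \ {x}) η.neg q.1.pos q.1.neg) ((lebPoisson2 d).prod volume) ∧
    Integrable (fun q : Conf2 d × E d =>
      ev k (q.1.pos ∪ η.pos) (q.1.neg ∪ η.neg) *
        KRate cp x q.2 (η.pos \ {x}) η.neg q.1.pos q.1.neg) ((lebPoisson2 d).prod volume))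

end TwoComp

end

/-! A pair of disjoint configurations is a finite set of points marked + or −, and each half of `L1`
or `L2` is one kind of operator: a point x of mark s hops to y and receives mark t. All four choices
of (s, t) are treated at once on sets of marked points. Sets in which a position carries both marks
form a null set, so this encoding loses nothing.

Two identities for the Lebesgue–Poisson measure carry the proof. A sum over all splittings of D into
two parts integrates to a double integral over both parts, because C(n,k)/n! = 1/(k!(n−k)!). A sum
over x ∈ D of a function of (D∖x, x) integrates to an integral over a configuration and a free
point, because (n+1)/(n+1)! = 1/n!. `SumTransfer` is their common form; `sumTransfer_pointed`
combines them.

The algebra is in `hopHat_eq`. The difference of Kg before and after a hop is the sum of g(Z∪y) −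
g(Z∪x) over Z ⊂ D∖x. Applying K⁻¹ and exchanging the sums collects the alternating sums of rates
into the kernel C, so that K⁻¹LKg(η) is the sum over ξ ⊂ η and x ∈ ξ of ∫ C(x, y, ξ∖x, η∖ξ)(g(ξ∖x∪y)
− g(ξ)) dy.

Paired with k this becomes the integral over ξ, x, ζ, y of Ψ = k(ξ∪x∪ζ) C(x, y, ξ, ζ) times g(ξ∪y) −
g(ξ∪x). Reading η = ξ∪y in the gain term and η = ξ∪x in the loss term, and using the Mecke formula
backwards, one arrives at the pairing of g with the dual expression (`hopHat_duality`).

All of this is legitimate once Ψ is absolutely integrable (`integrable_dualIntegrand`). The kernel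
is bounded by a sum of rates, integration over y produces total jump rates, and boundedness and
support of k leave the integral of the total rate over a bounded window, finite by hypothesis.
Fubini then also yields absolute convergence of the dual expression for a.e. η. Uniqueness follows
by testing with indicators of subsets of bounded windows (`IsDualImage.iff_ae_eq`). -/

noncomputable section

namespace TwoComp

variable {d : ℕ}

/-! ### Measurability on the space of configurations -/

/-- A function that agrees with measurable functions on the members of a countable measurable
cover is measurable. -/
theorem measurable_of_cover {α β ι : Type*} [Countable ι] [MeasurableSpace α] [MeasurableSpace β]
    {f : α → β} (s : ι → Set α) (hs : ∀ i, MeasurableSet (s i)) (hc : ∀ a, ∃ i, a ∈ s i)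
    (h : ∀ i, ∃ g : α → β, Measurable g ∧ ∀ a ∈ s i, f a = g a) : Measurable f := by
  choose g hg hfg using h
  intro t ht
  have : f ⁻¹' t = ⋃ i, s i ∩ g i ⁻¹' t := by
    ext a
    simp only [Set.mem_preimage, Set.mem_iUnion, Set.mem_inter_iff]
    constructor
    · intro ha
      obtain ⟨i, hi⟩ := hc a
      exact ⟨i, hi, hfg i a hi ▸ ha⟩
    · rintro ⟨i, hi, ha⟩
      exact (hfg i a hi).symm ▸ ha
  rw [this]
  exact MeasurableSet.iUnion fun i => (hs i).inter (hg i ht)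

theorem measurable_conf_iff {β : Type*} [MeasurableSpace β] {f : Conf d → β} :
    Measurable f ↔ ∀ n, Measurable fun x => f (toConf d n x) := by
  constructor
  · intro h n t ht
    exact measurableSet_conf.1 (h ht) n
  · intro h t ht
    exact measurableSet_conf.2 fun n => h n ht

theorem measurable_toConf (n : ℕ) : Measurable (toConf d n) :=
  measurable_conf_iff.1 measurable_id n

theorem card_toConf {n : ℕ} (x : Tuple d n) : (toConf d n x).pts.card = n := by
  simp [toConf, Finset.card_image_of_injective _ x.2]

theorem measurable_card : Measurable fun a : Conf d => a.pts.card := by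
  refine measurable_conf_iff.2 fun n => ?_
  simp only [card_toConf]
  exact measurable_const

/-- The number of points of a configuration that precede `x` in a fixed measurable linear order. -/
def rank (a : Conf d) (x : E d) : ℕ :=
  (a.pts.filter fun y => embeddingReal (E d) y < embeddingReal (E d) x).card

/-- The `i`-th point of a configuration in a fixed measurable linear order. -/
def pick (i : ℕ) (a : Conf d) : E d :=
  open Classical in if h : ∃ x ∈ a.pts, rank a x = i then h.choose else 0

/-- Of two points, the earlier one is counted in the rank of the later one but not in its own, so
the rank is strictly increasing along the order. -/
theorem rank_injOn (a : Conf d) : Set.InjOn (rank a) (a.pts : Set (E d)) := by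
  intro x hx y hy hxy
  have key : ∀ u ∈ a.pts, ∀ v, embeddingReal (E d) u < embeddingReal (E d) v →
      rank a u < rank a v := by
    intro u hu v huv
    refine Finset.card_lt_card ((Finset.ssubset_iff_of_subset ?_).2 ⟨u, ?_, ?_⟩)
    · intro w hw
      simp only [Finset.mem_filter] at hw ⊢
      exact ⟨hw.1, hw.2.trans huv⟩
    · simp [hu, huv]
    · simp
  rcases lt_trichotomy (embeddingReal (E d) x) (embeddingReal (E d) y) with h | h | h
  · exact absurd hxy (key x hx y h).ne
  · exact (measurableEmbedding_embeddingReal (E d)).injective h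
  · exact absurd hxy (key y hy x h).ne'

theorem rank_lt {a : Conf d} {x : E d} (hx : x ∈ a.pts) : rank a x < a.pts.card :=
  Finset.card_lt_card (Finset.filter_ssubset.2 ⟨x, hx, by simp⟩)

theorem exists_rank_eq {a : Conf d} {i : ℕ} (hi : i < a.pts.card) :
    ∃ x ∈ a.pts, rank a x = i := by
  have := Finset.surjOn_of_injOn_of_card_le (s := a.pts) (t := Finset.range a.pts.card) (rank a)
    (fun x hx => by simpa using rank_lt hx) (rank_injOn a) (by simp)
  simpa using this (by simpa using hi)

theorem pick_mem {a : Conf d} {i : ℕ} (hi : i < a.pts.card) : pick i a ∈ a.pts := by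
  rw [pick, dif_pos (exists_rank_eq hi)]
  exact (exists_rank_eq hi).choose_spec.1

theorem rank_pick {a : Conf d} {i : ℕ} (hi : i < a.pts.card) : rank a (pick i a) = i := by
  rw [pick, dif_pos (exists_rank_eq hi)]
  exact (exists_rank_eq hi).choose_spec.2

theorem pick_rank {a : Conf d} {x : E d} (hx : x ∈ a.pts) : pick (rank a x) a = x :=
  rank_injOn a (pick_mem (rank_lt hx)) hx (rank_pick (rank_lt hx))

theorem pick_injective {a : Conf d} {n : ℕ} (h : a.pts.card = n) :
    Function.Injective fun i : Fin n => pick i a := by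
  intro i j hij
  have := congrArg (rank a) hij
  simp only [] at this
  rw [rank_pick (h ▸ i.2), rank_pick (h ▸ j.2)] at this
  exact Fin.ext this

theorem image_pick {a : Conf d} {n : ℕ} (h : a.pts.card = n) :
    (Finset.univ.image fun i : Fin n => pick i a) = a.pts := by
  ext x
  simp only [Finset.mem_image, Finset.mem_univ, true_and]
  constructor
  · rintro ⟨i, rfl⟩
    exact pick_mem (h ▸ i.2)
  · intro hx
    exact ⟨⟨rank a x, h ▸ rank_lt hx⟩, pick_rank hx⟩

theorem measurable_rank (n : ℕ) (j : Fin n) :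
    Measurable fun x : Tuple d n => rank (toConf d n x) (x.1 j) := by
  have : (fun x : Tuple d n => rank (toConf d n x) (x.1 j)) = fun x =>
      ∑ l : Fin n, if embeddingReal (E d) (x.1 l) < embeddingReal (E d) (x.1 j) then 1 else 0 := by
    ext x
    rw [rank, toConf, Finset.filter_image, Finset.card_image_of_injective _ x.2,
      Finset.card_filter]
  rw [this]
  have he := (measurableEmbedding_embeddingReal (E d)).measurable
  have hx : ∀ l : Fin n, Measurable fun x : Tuple d n => embeddingReal (E d) (x.1 l) := fun l =>
    he.comp ((measurable_pi_apply l).comp measurable_subtype_coe)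
  exact Finset.measurable_sum _ fun l _ =>
    Measurable.ite (measurableSet_lt (hx l) (hx j)) measurable_const measurable_const

/-- This provides a measurable enumeration of an unordered configuration. Together with
`measurable_card` it reduces measurability of operations on configurations to that of operations on
finitely many points. -/
theorem measurable_pick (i : ℕ) : Measurable (pick i : Conf d → E d) := by
  refine measurable_conf_iff.2 fun n => ?_
  -- On `some j` the coordinate `x j` has rank `i` and is the point picked; on `none` no coordinate
  -- has rank `i`, and `pick` takes its default value 0.
  refine measurable_of_cover (ι := Option (Fin n)) (fun o => o.elim
    {x | ∀ j, rank (toConf d n x) (x.1 j) ≠ i} fun j => {x | rank (toConf d n x) (x.1 j) = i})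
    ?_ ?_ ?_
  · rintro (_ | j)
    · simp only [Option.elim, ne_eq, Set.ofPred_forall]
      exact MeasurableSet.iInter fun j =>
        (measurable_rank n j (measurableSet_singleton i)).compl
    · exact measurable_rank n j (measurableSet_singleton i)
  · intro x
    by_cases h : ∃ j, rank (toConf d n x) (x.1 j) = i
    · exact ⟨some h.choose, h.choose_spec⟩
    · exact ⟨none, by simpa using h⟩
  · rintro (_ | j)
    · refine ⟨fun _ => 0, measurable_const, fun x hx => ?_⟩
      rw [pick, dif_neg]
      rintro ⟨y, hy, hi⟩
      simp only [toConf, Finset.mem_image, Finset.mem_univ, true_and] at hy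
      obtain ⟨j, rfl⟩ := hy
      exact hx j hi
    · refine ⟨fun x => x.1 j, (measurable_pi_apply j).comp measurable_subtype_coe, fun x hx => ?_⟩
      have hj : x.1 j ∈ (toConf d n x).pts := by simp [toConf]
      have hx' : rank (toConf d n x) (x.1 j) = i := hx
      rw [← hx', pick_rank hj]

theorem measurableSet_mem : MeasurableSet {p : E d × Conf d | p.1 ∈ p.2.pts} := by
  have : {p : E d × Conf d | p.1 ∈ p.2.pts} =
      ⋃ i : ℕ, {p | i < p.2.pts.card} ∩ {p | p.1 = pick i p.2} := by
    ext ⟨x, a⟩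
    simp only [Set.mem_ofPred_eq, Set.mem_iUnion, Set.mem_inter_iff]
    constructor
    · intro hx
      exact ⟨rank a x, rank_lt hx, (pick_rank hx).symm⟩
    · rintro ⟨i, hi, rfl⟩
      exact pick_mem hi
  rw [this]
  exact MeasurableSet.iUnion fun i =>
    ((measurable_card.comp measurable_snd) (measurableSet_Ioi (a := i))).inter
      (measurableSet_eq_fun measurable_fst ((measurable_pick i).comp measurable_snd))

/-! ### Measurability of set operations and of finite sums over configurations -/

theorem measurable_insert :
    Measurable fun p : E d × Conf d => (⟨insert p.1 p.2.pts⟩ : Conf d) := by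
  classical
  refine measurable_of_cover (ι := Option ℕ) (fun o => o.elim {p | p.1 ∈ p.2.pts}
    fun n => {p | p.1 ∈ p.2.pts}ᶜ ∩ {p | p.2.pts.card = n}) ?_ ?_ ?_
  · rintro (_ | n)
    · exact measurableSet_mem
    · exact measurableSet_mem.compl.inter
        ((measurable_card.comp measurable_snd) (measurableSet_singleton n))
  · intro p
    by_cases h : p.1 ∈ p.2.pts
    · exact ⟨none, h⟩
    · exact ⟨some p.2.pts.card, h, rfl⟩
  · rintro (_ | n)
    · refine ⟨fun p => p.2, measurable_snd, fun p hp => ?_⟩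
      have hp' : p.1 ∈ p.2.pts := hp
      ext1
      simp [hp']
    · let q : E d × Conf d → Fin (n + 1) → E d := fun p => Fin.cons p.1 fun i => pick i p.2
      have hq : Measurable q := by
        refine measurable_pi_lambda _ fun i => ?_
        refine Fin.cases ?_ (fun i => ?_) i
        · exact measurable_fst
        · exact (measurable_pick i).comp measurable_snd
      let s : Set (E d × Conf d) := {p | Function.Injective (q p)}
      have hs : MeasurableSet s := by
        have : s = ⋂ i, ⋂ j, {p | q p i = q p j → i = j} := by
          ext p
          simp [s, Function.Injective]
        rw [this]
        refine MeasurableSet.iInter fun i => MeasurableSet.iInter fun j => ?_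
        by_cases hij : i = j
        · simp [hij]
        · simp only [hij, imp_false]
          exact (measurableSet_eq_fun ((measurable_pi_apply i).comp hq)
            ((measurable_pi_apply j).comp hq)).compl
      -- The value `⟨∅⟩` off `s` is never used: on this member of the cover the new point differs
      -- from the enumerated ones, so the tuple is injective.
      refine ⟨fun p => if h : p ∈ s then toConf d (n + 1) ⟨q p, h⟩ else ⟨∅⟩,
        Measurable.dite (s := s)
          (f := fun p => toConf d (n + 1) ⟨q p.1, p.2⟩) (g := fun _ => ⟨∅⟩)
          ((measurable_toConf _).comp ((hq.comp measurable_subtype_coe).subtype_mk))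
          measurable_const hs, ?_⟩
      rintro ⟨x, a⟩ ⟨hx, ha⟩
      simp only [Set.mem_compl_iff, Set.mem_ofPred_eq] at hx ha
      have hinj : (x, a) ∈ s := by
        refine Fin.cons_injective_iff.2 ⟨?_, pick_injective ha⟩
        rintro ⟨i, hi⟩
        have hi : pick i a = x := hi
        exact hx (hi ▸ pick_mem (ha ▸ i.2))
      refine Eq.trans ?_ (dif_pos hinj).symm
      ext1
      have := image_pick ha
      simp only [toConf, q]
      rw [← this]
      ext y
      simp [Fin.exists_fin_succ, eq_comm]

theorem measurable_image {α ι : Type*} [MeasurableSpace α] (T : Finset ι) {f : ι → α → E d}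
    (hf : ∀ i, Measurable (f i)) :
    Measurable fun y => (⟨T.image fun i => f i y⟩ : Conf d) := by
  classical
  induction T using Finset.induction_on with
  | empty => simp only [Finset.image_empty]; exact measurable_const
  | insert i T _ ih =>
    simp only [Finset.image_insert]
    exact measurable_insert.comp ((hf i).prodMk ih)

theorem measurable_union :
    Measurable fun p : Conf d × Conf d => (⟨p.1.pts ∪ p.2.pts⟩ : Conf d) := by
  refine measurable_of_cover (ι := ℕ × ℕ)
    (fun n => {p | p.1.pts.card = n.1} ∩ {p | p.2.pts.card = n.2}) (fun n => ?_)
    (fun p => ⟨(_, _), rfl, rfl⟩) fun n => ?_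
  · exact ((measurable_card.comp measurable_fst) (measurableSet_singleton _)).inter
      ((measurable_card.comp measurable_snd) (measurableSet_singleton _))
  · refine ⟨fun p => ⟨Finset.univ.image fun i : Fin n.1 ⊕ Fin n.2 =>
      Sum.elim (fun i : Fin n.1 => pick i p.1) (fun i : Fin n.2 => pick i p.2) i⟩, measurable_image _ ?_, ?_⟩
    · rintro (i | i)
      · exact (measurable_pick i).comp measurable_fst
      · exact (measurable_pick i).comp measurable_snd
    · rintro ⟨a, b⟩ ⟨ha, hb⟩
      have ha := image_pick ha
      have hb := image_pick hb
      simp only at ha hb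
      ext1
      simp only
      conv_lhs => rw [← ha, ← hb]
      ext y
      simp

theorem sum_powerset_image {ι α β : Type*} [DecidableEq α] [AddCommMonoid β] [DecidableEq ι]
    {T : Finset ι} {q : ι → α} (hq : Function.Injective q) (f : Finset α → Finset α → β) :
    ∑ A ∈ (T.image q).powerset, f A (T.image q \ A) =
      ∑ S ∈ T.powerset, f (S.image q) ((T \ S).image q) := by
  rw [Finset.powerset_image, Finset.sum_image (Finset.image_injective hq).injOn]
  exact Finset.sum_congr rfl fun S _ => by rw [Finset.image_sdiff _ _ hq]

/-- Where the configuration has exactly n points, its enumeration replaces the varying range of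
summation by the fixed set of subsets of `Fin n`. -/
theorem measurable_sum_powerset {α β : Type*} [MeasurableSpace α] [AddCommMonoid β]
    [MeasurableSpace β] [MeasurableAdd₂ β] {f : Conf d → Conf d → α → β}
    (hf : Measurable fun q : Conf d × Conf d × α => f q.1 q.2.1 q.2.2) {a : α → Conf d}
    (ha : Measurable a) :
    Measurable fun y => ∑ A ∈ (a y).pts.powerset, f ⟨A⟩ ⟨(a y).pts \ A⟩ y := by
  refine measurable_of_cover (fun n : ℕ => {y | (a y).pts.card = n})
    (fun n => (measurable_card.comp ha) (measurableSet_singleton _))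
    (fun p => ⟨_, rfl⟩) fun n => ?_
  refine ⟨fun y => ∑ S : Finset (Fin n), f ⟨S.image fun i : Fin n => pick i (a y)⟩
    ⟨Sᶜ.image fun i : Fin n => pick i (a y)⟩ y, ?_, ?_⟩
  · refine Finset.measurable_sum _ fun S _ => ?_
    have hp : ∀ i : Fin n, Measurable fun y => pick i (a y) := fun i => (measurable_pick i).comp ha
    exact hf.comp ((measurable_image S hp).prodMk ((measurable_image Sᶜ hp).prodMk measurable_id))
  · intro y hy
    have := sum_powerset_image (T := Finset.univ) (pick_injective hy)
      fun A B => f ⟨A⟩ ⟨B⟩ y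
    rw [image_pick hy] at this
    simpa [Finset.compl_eq_univ_sdiff] using this

theorem sum_image_erase {ι α β : Type*} [DecidableEq α] [AddCommMonoid β] [DecidableEq ι]
    {T : Finset ι} {q : ι → α} (hq : Function.Injective q) (f : α → Finset α → β) :
    ∑ x ∈ T.image q, f x ((T.image q).erase x) = ∑ i ∈ T, f (q i) ((T.erase i).image q) := by
  rw [Finset.sum_image hq.injOn]
  exact Finset.sum_congr rfl fun S _ => by rw [Finset.image_erase hq]

theorem measurable_sum_erase {α β : Type*} [MeasurableSpace α] [AddCommMonoid β]
    [MeasurableSpace β] [MeasurableAdd₂ β] {f : E d → Conf d → α → β}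
    (hf : Measurable fun q : E d × Conf d × α => f q.1 q.2.1 q.2.2) {a : α → Conf d}
    (ha : Measurable a) :
    Measurable fun y => ∑ x ∈ (a y).pts, f x ⟨(a y).pts.erase x⟩ y := by
  refine measurable_of_cover (fun n : ℕ => {y | (a y).pts.card = n})
    (fun n => (measurable_card.comp ha) (measurableSet_singleton _))
    (fun p => ⟨_, rfl⟩) fun n => ?_
  refine ⟨fun y => ∑ i : Fin n, f (pick i (a y))
    ⟨(Finset.univ.erase i).image fun i : Fin n => pick i (a y)⟩ y, ?_, ?_⟩
  · refine Finset.measurable_sum _ fun i _ => ?_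
    have hp : ∀ i : Fin n, Measurable fun y => pick i (a y) := fun i => (measurable_pick i).comp ha
    exact hf.comp ((hp i).prodMk ((measurable_image _ hp).prodMk measurable_id))
  · intro y hy
    have := sum_image_erase (T := Finset.univ) (pick_injective hy) fun x B => f x ⟨B⟩ y
    rw [image_pick hy] at this
    exact this

/-! ### The Lebesgue–Poisson measure -/

theorem measurableSet_injective (n : ℕ) :
    MeasurableSet {x : Fin n → E d | Function.Injective x} := by
  have : {x : Fin n → E d | Function.Injective x} = ⋂ i, ⋂ j, {x | x i = x j → i = j} := by
    ext x
    simp [Function.Injective]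
  rw [this]
  refine MeasurableSet.iInter fun i => MeasurableSet.iInter fun j => ?_
  by_cases hij : i = j
  · simp [hij]
  · simp only [hij, imp_false]
    exact (measurableSet_eq_fun (measurable_pi_apply i) (measurable_pi_apply j)).compl

theorem nontrivial_E (hd : 0 < d) : Nontrivial (E d) := by
  have : Nonempty (Fin d) := ⟨⟨0, hd⟩⟩
  infer_instance

/-- A collision of two coordinates confines the tuple to a linear subspace, which is proper because
d > 0, hence null. -/
theorem ae_injective (hd : 0 < d) (n : ℕ) :
    ∀ᵐ x : Fin n → E d, Function.Injective x := by
  have := nontrivial_E hd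
  have key : ∀ i j : Fin n, i ≠ j → ∀ᵐ x : Fin n → E d, x i ≠ x j := by
    intro i j hij
    let S : Submodule ℝ (Fin n → E d) :=
      LinearMap.eqLocus (LinearMap.proj i : (Fin n → E d) →ₗ[ℝ] E d) (LinearMap.proj j)
    have hS : S ≠ ⊤ := by
      intro h
      obtain ⟨v, hv⟩ := exists_ne (0 : E d)
      have : (Pi.single i v : Fin n → E d) ∈ S := h ▸ Submodule.mem_top
      simp only [S, LinearMap.mem_eqLocus, LinearMap.proj_apply, Pi.single_eq_same] at this
      rw [Pi.single_eq_of_ne hij.symm] at this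
      exact hv this
    have h0 := Measure.addHaar_submodule (volume : Measure (Fin n → E d)) S hS
    rw [ae_iff]
    convert h0 using 2
    ext x
    simp [S, LinearMap.mem_eqLocus]
  have : ∀ᵐ x : Fin n → E d, ∀ i j, i ≠ j → x i ≠ x j := by
    rw [ae_all_iff]; intro i
    rw [ae_all_iff]; intro j
    by_cases h : i = j
    · simp [h]
    · simpa [h] using key i j h
  filter_upwards [this] with x hx i j hij
  by_contra h
  exact hx i j h hij

theorem lintegral_lebPoisson (hd : 0 < d) {f : Conf d → ℝ≥0∞} (hf : Measurable f) :
    ∫⁻ a, f a ∂lebPoisson d =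
      ∑' n : ℕ, (n ! : ℝ≥0∞)⁻¹ * ∫⁻ x : Fin n → E d, f ⟨Finset.univ.image x⟩ := by
  rw [lebPoisson, lintegral_sum_measure]
  refine tsum_congr fun n => ?_
  rw [lintegral_smul_measure, lintegral_map hf (measurable_toConf n), smul_eq_mul]
  congr 1
  have h := lintegral_subtype_comap (μ := (volume : Measure (Fin n → E d)))
    (measurableSet_injective n) fun x => f ⟨Finset.univ.image x⟩
  refine h.trans ?_
  rw [Measure.restrict_eq_self_of_ae_mem (s := {x | Function.Injective x}) (ae_injective hd n)]

theorem sFinite_comap {α β : Type*} [MeasurableSpace α] [MeasurableSpace β] {f : α → β}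
    (hf : MeasurableEmbedding f) (μ : Measure β) [SFinite μ] : SFinite (μ.comap f) := by
  have : μ.comap f = Measure.sum fun n => (sfiniteSeq μ n).comap f := by
    ext s hs
    rw [hf.comap_apply, Measure.sum_apply _ hs]
    conv_lhs => rw [← sum_sfiniteSeq μ]
    rw [Measure.sum_apply _ (hf.measurableSet_image.2 hs)]
    exact tsum_congr fun n => (hf.comap_apply _ _).symm
  rw [this]
  infer_instance

instance : SFinite (lebPoisson d) := by
  unfold lebPoisson
  have : ∀ n : ℕ, SFinite (Measure.comap (Subtype.val : Tuple d n → Fin n → E d) volume) :=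
    fun n => by
      exact sFinite_comap (MeasurableEmbedding.subtype_coe (measurableSet_injective n)) _
  infer_instance

/-- The Mecke formula. -/
theorem lintegral_sum_erase (hd : 0 < d) {f : E d × Conf d → ℝ≥0∞} (hf : Measurable f) :
    ∫⁻ a, ∑ x ∈ a.pts, f (x, ⟨a.pts.erase x⟩) ∂lebPoisson d =
      ∫⁻ p, f p ∂(volume : Measure (E d)).prod (lebPoisson d) := by
  have hm : Measurable fun a : Conf d => ∑ x ∈ a.pts, f (x, ⟨a.pts.erase x⟩) :=
    measurable_sum_erase (f := fun x a _ => f (x, a)) (by fun_prop) measurable_id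
  -- The empty configuration has no point to remove, so the term n = 0 vanishes and the series
  -- shifts by one: removing a point from n + 1 points leaves n.
  rw [lintegral_lebPoisson hd hm, tsum_eq_zero_add' ENNReal.summable, lintegral_prod_symm' _ hf,
    lintegral_lebPoisson hd (Measurable.lintegral_prod_left' hf)]
  have h0 : ∫⁻ x : Fin 0 → E d, ∑ y ∈ Finset.univ.image x,
      f (y, ⟨(Finset.univ.image x).erase y⟩) = 0 := by simp
  rw [h0, mul_zero, zero_add]
  refine tsum_congr fun n => ?_
  have hi : ∀ i : Fin (n + 1),
      Measurable fun x : Fin (n + 1) → E d =>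
        f (x i, ⟨(Finset.univ.erase i).image x⟩) := fun i =>
    hf.comp ((measurable_pi_apply i).prodMk
      (measurable_image _ fun j => measurable_pi_apply j))
  have h1 : ∫⁻ x : Fin (n + 1) → E d, ∑ y ∈ Finset.univ.image x,
      f (y, ⟨(Finset.univ.image x).erase y⟩) =
      ∫⁻ x : Fin (n + 1) → E d, ∑ i, f (x i, ⟨(Finset.univ.erase i).image x⟩) := by
    refine lintegral_congr_ae ?_
    filter_upwards [ae_injective hd (n + 1)] with x hx
    exact sum_image_erase hx fun y B => f (y, ⟨B⟩)
  have h2 : ∀ i : Fin (n + 1), ∫⁻ x : Fin (n + 1) → E d,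
      f (x i, ⟨(Finset.univ.erase i).image x⟩) =
        ∫⁻ z : Fin n → E d, ∫⁻ y : E d, f (y, ⟨Finset.univ.image z⟩) := by
    intro i
    have hF : Measurable fun p : E d × (Fin n → E d) => f (p.1, ⟨Finset.univ.image p.2⟩) :=
      hf.comp (measurable_fst.prodMk
        (measurable_image _ fun j => (measurable_pi_apply j).comp measurable_snd))
    -- Splitting off coordinate `i` shows that all n + 1 summands have the same integral. Their
    -- number then turns 1/(n+1)! into 1/n!.
    have := (volume_preserving_piFinSuccAbove (fun _ : Fin (n + 1) => E d) i).lintegral_comp hF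
    rw [Measure.volume_eq_prod, lintegral_prod_symm' _ hF] at this
    rw [← this]
    refine lintegral_congr fun x => ?_
    congr 3
    ext y
    simp only [MeasurableEquiv.piFinSuccAbove_apply, Fin.insertNthEquiv_symm_apply,
      Finset.mem_image, Finset.mem_erase, Finset.mem_univ, and_true, true_and, Fin.removeNth]
    constructor
    · rintro ⟨j, hj, rfl⟩
      obtain ⟨k, rfl⟩ := Fin.exists_succAbove_eq hj
      exact ⟨k, rfl⟩
    · rintro ⟨k, rfl⟩
      exact ⟨_, Fin.succAbove_ne i k, rfl⟩
  rw [h1, lintegral_finsetSum _ fun i _ => hi i, Finset.sum_congr rfl fun i _ => h2 i]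
  simp only [Finset.sum_const, Finset.card_univ, Fintype.card_fin, nsmul_eq_mul]
  rw [← mul_assoc, Nat.factorial_succ]
  congr 1
  push_cast
  rw [ENNReal.mul_inv (by left; positivity) (by left; finiteness), mul_right_comm,
    ENNReal.inv_mul_cancel (by positivity) (by finiteness), one_mul]

theorem lintegral_image_equiv {ι κ : Type*} [Fintype ι] [Fintype κ] (e : ι ≃ κ)
    {g : Conf d → ℝ≥0∞} (hg : Measurable g) :
    ∫⁻ x : ι → E d, g ⟨Finset.univ.image x⟩ = ∫⁻ x : κ → E d, g ⟨Finset.univ.image x⟩ := by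
  have := (volume_measurePreserving_piCongrLeft (fun _ : κ => E d) e).lintegral_comp
    (hg.comp (measurable_image Finset.univ fun j => measurable_pi_apply j))
  refine Eq.trans (lintegral_congr fun x => ?_) this
  simp only [Function.comp]
  congr 2
  ext y
  simp only [Finset.mem_image, Finset.mem_univ, true_and]
  constructor
  · rintro ⟨i, rfl⟩
    exact ⟨e i, by simp [MeasurableEquiv.coe_piCongrLeft, Equiv.piCongrLeft_apply_apply]⟩
  · rintro ⟨k, rfl⟩
    obtain ⟨i, rfl⟩ := e.surjective k
    exact ⟨i, by simp [MeasurableEquiv.coe_piCongrLeft, Equiv.piCongrLeft_apply_apply]⟩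

/-- Fubini for the coordinates inside and outside `S`, followed by relabelling. The result depends
on `S` only through its cardinality, which is where binomial coefficients come from. -/
theorem lintegral_image_split {n : ℕ} (S : Finset (Fin n))
    {f : Conf d × Conf d → ℝ≥0∞} (hf : Measurable f) :
    ∫⁻ x : Fin n → E d, f (⟨S.image x⟩, ⟨Sᶜ.image x⟩) =
      ∫⁻ x : Fin S.card → E d, ∫⁻ y : Fin (n - S.card) → E d,
        f (⟨Finset.univ.image x⟩, ⟨Finset.univ.image y⟩) := by
  have hF : Measurable fun p : ({i // i ∈ S} → E d) × ({i // i ∉ S} → E d) =>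
      f (⟨Finset.univ.image p.1⟩, ⟨Finset.univ.image p.2⟩) :=
    hf.comp ((measurable_image _ fun j => (measurable_pi_apply j).comp measurable_fst).prodMk
      (measurable_image _ fun j => (measurable_pi_apply j).comp measurable_snd))
  have := (volume_preserving_piEquivPiSubtypeProd (fun _ : Fin n => E d)
    (fun i => i ∈ S)).lintegral_comp hF
  rw [Measure.volume_eq_prod, lintegral_prod _ hF.aemeasurable] at this
  have e1 : {i // i ∈ S} ≃ Fin S.card := S.equivFin
  have e2 : {i // i ∉ S} ≃ Fin (n - S.card) :=
    Fintype.equivFinOfCardEq (by simp [Fintype.card_subtype_compl])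
  have h2 : ∀ a : Conf d, ∫⁻ y : {i // i ∉ S} → E d, f (a, ⟨Finset.univ.image y⟩) =
      ∫⁻ y : Fin (n - S.card) → E d, f (a, ⟨Finset.univ.image y⟩) := fun a =>
    lintegral_image_equiv e2 (g := fun b => f (a, b)) (hf.comp (by fun_prop))
  simp only [h2] at this
  have h1 := lintegral_image_equiv e1 (d := d)
    (g := fun a => ∫⁻ y : Fin (n - S.card) → E d, f (a, ⟨Finset.univ.image y⟩)) (by
      refine Measurable.lintegral_prod_right'
        (f := fun p : Conf d × (Fin (n - S.card) → E d) => f (p.1, ⟨Finset.univ.image p.2⟩)) ?_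
      exact hf.comp (measurable_fst.prodMk
        (measurable_image _ fun j => (measurable_pi_apply j).comp measurable_snd)))
  refine Eq.trans (lintegral_congr fun x => ?_) (this.trans (Eq.trans ?_ h1))
  rotate_left
  · congr!
  congr 3
  · ext y
    simp [MeasurableEquiv.piEquivPiSubtypeProd, Equiv.piEquivPiSubtypeProd]
  · ext y
    simp [MeasurableEquiv.piEquivPiSubtypeProd, Equiv.piEquivPiSubtypeProd]

/-- Integration of a sum over all splittings of a configuration into two parts. -/
theorem lintegral_sum_powerset (hd : 0 < d) {f : Conf d × Conf d → ℝ≥0∞} (hf : Measurable f) :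
    ∫⁻ a, ∑ A ∈ a.pts.powerset, f (⟨A⟩, ⟨a.pts \ A⟩) ∂lebPoisson d =
      ∫⁻ p, f p ∂(lebPoisson d).prod (lebPoisson d) := by
  have hm : Measurable fun a : Conf d => ∑ A ∈ a.pts.powerset, f (⟨A⟩, ⟨a.pts \ A⟩) :=
    measurable_sum_powerset (f := fun a b _ => f (a, b)) (by fun_prop) measurable_id
  let J : ℕ → ℕ → ℝ≥0∞ := fun k l => ∫⁻ x : Fin k → E d, ∫⁻ y : Fin l → E d,
    f (⟨Finset.univ.image x⟩, ⟨Finset.univ.image y⟩)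
  have hi : ∀ n, ∀ S : Finset (Fin n),
      Measurable fun x : Fin n → E d => f (⟨S.image x⟩, ⟨Sᶜ.image x⟩) := fun n S =>
    hf.comp ((measurable_image _ fun j => measurable_pi_apply j).prodMk
      (measurable_image _ fun j => measurable_pi_apply j))
  have hl : ∀ n : ℕ, ∫⁻ x : Fin n → E d, ∑ A ∈ (Finset.univ.image x).powerset,
      f (⟨A⟩, ⟨Finset.univ.image x \ A⟩) =
        ∑ k ∈ Finset.range (n + 1), n.choose k * J k (n - k) := by
    intro n
    have h1 : ∫⁻ x : Fin n → E d, ∑ A ∈ (Finset.univ.image x).powerset,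
        f (⟨A⟩, ⟨Finset.univ.image x \ A⟩) =
        ∫⁻ x : Fin n → E d, ∑ S ∈ Finset.univ.powerset, f (⟨S.image x⟩, ⟨Sᶜ.image x⟩) := by
      refine lintegral_congr_ae ?_
      filter_upwards [ae_injective hd n] with x hx
      exact sum_powerset_image hx fun A B => f (⟨A⟩, ⟨B⟩)
    rw [h1, lintegral_finsetSum _ fun S _ => hi n S,
      Finset.sum_congr rfl fun S _ => lintegral_image_split S hf]
    have := Finset.sum_powerset_apply_card (fun k => J k (n - k)) (x := (Finset.univ : Finset (Fin n)))
    simpa using this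
  have hr : ∀ b : Conf d × Conf d → ℝ≥0∞, Measurable b →
      ∀ n, Measurable fun a : Conf d => ∫⁻ y : Fin n → E d, b (a, ⟨Finset.univ.image y⟩) := by
    intro b hb n
    refine Measurable.lintegral_prod_right'
      (f := fun p : Conf d × (Fin n → E d) => b (p.1, ⟨Finset.univ.image p.2⟩)) ?_
    exact hb.comp (measurable_fst.prodMk
      (measurable_image _ fun j => (measurable_pi_apply j).comp measurable_snd))
  have hrhs : ∫⁻ p, f p ∂(lebPoisson d).prod (lebPoisson d) =
      ∑' p : ℕ × ℕ, (p.1 ! : ℝ≥0∞)⁻¹ * (p.2 ! : ℝ≥0∞)⁻¹ * J p.1 p.2 := by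
    rw [lintegral_prod _ hf.aemeasurable]
    have h1 : ∀ a : Conf d, ∫⁻ b, f (a, b) ∂lebPoisson d = ∑' l : ℕ, (l ! : ℝ≥0∞)⁻¹ *
        ∫⁻ y : Fin l → E d, f (a, ⟨Finset.univ.image y⟩) := fun a =>
      lintegral_lebPoisson hd (hf.comp (by fun_prop))
    simp only [h1]
    rw [lintegral_tsum fun l => ((hr f hf l).const_mul _).aemeasurable,
      ENNReal.tsum_prod (f := fun k l => (k ! : ℝ≥0∞)⁻¹ * (l ! : ℝ≥0∞)⁻¹ * J k l),
      ENNReal.tsum_comm]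
    refine tsum_congr fun l => ?_
    rw [lintegral_const_mul _ (hr f hf l), lintegral_lebPoisson hd (hr f hf l),
      ← ENNReal.tsum_mul_left]
    refine tsum_congr fun k => ?_
    ring
  -- The double series over the sizes (k, l) of the two parts is summed along k + l = n and compared
  -- with the left side term by term, through C(n,k)/n! = 1/(k!(n−k)!).
  rw [lintegral_lebPoisson hd hm, hrhs,
    ← Finset.HasAntidiagonal.sigmaAntidiagonalEquivProd.tsum_eq, ENNReal.tsum_sigma']
  refine tsum_congr fun n => ?_
  rw [hl, tsum_fintype, Finset.mul_sum]
  simp only [Finset.HasAntidiagonal.sigmaAntidiagonalEquivProd_apply]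
  rw [Finset.sum_coe_sort (Finset.HasAntidiagonal.antidiagonal n) fun p =>
    (p.1 ! : ℝ≥0∞)⁻¹ * (p.2 ! : ℝ≥0∞)⁻¹ * J p.1 p.2,
    Finset.Nat.sum_antidiagonal_eq_sum_range_succ_mk]
  refine Finset.sum_congr rfl fun k hk => ?_
  have hk : k ≤ n := Nat.lt_succ_iff.1 (Finset.mem_range.1 hk)
  rw [← mul_assoc]
  congr 1
  have h := Nat.choose_mul_factorial_mul_factorial hk
  have h' : (n ! : ℝ≥0∞) = n.choose k * (k ! * (n - k)!) := by
    rw [← h]; push_cast; ring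
  have hc : (n.choose k : ℝ≥0∞) ≠ 0 := by exact_mod_cast (Nat.choose_pos hk).ne'
  have hk0 : (k ! : ℝ≥0∞) ≠ 0 := by exact_mod_cast k.factorial_ne_zero
  rw [h', ENNReal.mul_inv (Or.inl hc) (Or.inl (by finiteness)),
    ENNReal.mul_inv (Or.inl hk0) (Or.inl (by finiteness)), mul_right_comm,
    ENNReal.inv_mul_cancel hc (by finiteness), one_mul]

/-- By the Mecke formula the integral of the number of points at `x` is the volume of `{x}` times
the total mass of λ. The first factor is 0, so the product vanishes. -/
theorem ae_notMem (hd : 0 < d) (x : E d) : ∀ᵐ a ∂lebPoisson d, x ∉ a.pts := by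
  have := nontrivial_E hd
  have hm : MeasurableSet {p : E d × Conf d | p.1 = x} := measurable_fst (measurableSet_singleton x)
  have h := lintegral_sum_erase hd (f := Set.indicator {p : E d × Conf d | p.1 = x} 1)
    (measurable_one.indicator hm)
  rw [lintegral_indicator_one hm] at h
  have h0 : {p : E d × Conf d | p.1 = x} = {x} ×ˢ Set.univ := by ext; simp
  rw [h0, Measure.prod_prod, measure_singleton, zero_mul] at h
  have hg : Measurable (Set.indicator ({x} ×ˢ Set.univ) (1 : E d × Conf d → ℝ≥0∞)) :=
    measurable_one.indicator (h0 ▸ hm)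
  have hm' : Measurable fun a : Conf d => ∑ y ∈ a.pts,
      Set.indicator ({x} ×ˢ Set.univ) (1 : E d × Conf d → ℝ≥0∞) (y, ⟨a.pts.erase y⟩) :=
    measurable_sum_erase (f := fun y a (_ : Conf d) =>
      Set.indicator (({x} : Set (E d)) ×ˢ Set.univ) (1 : E d × Conf d → ℝ≥0∞) (y, a))
      (hg.comp (by fun_prop : Measurable fun q : E d × Conf d × Conf d => (q.1, q.2.1)))
      measurable_id
  rw [lintegral_eq_zero_iff hm'] at h
  filter_upwards [h] with a ha hx
  have := (Finset.sum_eq_zero_iff.1 ha) x hx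
  simp at this

/-- Only the terms n ≤ N contribute, and the n-th is at most vol(Λ)ⁿ/n!. -/
theorem lebPoisson_lt_top {Λ : Set (E d)} (hΛ : MeasurableSet Λ) (hb : Bornology.IsBounded Λ)
    (N : ℕ) : lebPoisson d {a | (a.pts : Set (E d)) ⊆ Λ ∧ a.pts.card ≤ N} < ⊤ := by
  have hS : MeasurableSet {a : Conf d | (a.pts : Set (E d)) ⊆ Λ ∧ a.pts.card ≤ N} :=
    (measurableSet_subset hΛ).inter (measurable_card measurableSet_Iic)
  rw [lebPoisson, Measure.sum_apply _ hS, tsum_eq_sum (s := Finset.range (N + 1))]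
  · refine ENNReal.sum_lt_top.2 fun n _ => ?_
    rw [Measure.smul_apply, smul_eq_mul, Measure.map_apply (measurable_toConf n) hS,
      comap_subtype_coe_apply (measurableSet_injective n)]
    refine ENNReal.mul_lt_top (ENNReal.inv_lt_top.2 (by exact_mod_cast n.factorial_pos)) ?_
    refine (measure_mono (t := Set.univ.pi fun _ => Λ) ?_).trans_lt ?_
    · rintro _ ⟨x, hx, rfl⟩ i -
      exact hx.1 (by simp [toConf])
    · rw [volume_pi_pi]
      exact ENNReal.prod_lt_top fun _ _ => hb.measure_lt_top
  · intro n hn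
    rw [Measure.smul_apply, Measure.map_apply (measurable_toConf n) hS]
    have : toConf d n ⁻¹' {a : Conf d | (a.pts : Set (E d)) ⊆ Λ ∧ a.pts.card ≤ N} = ∅ := by
      ext x
      simp only [Set.mem_preimage, Set.mem_ofPred_eq, card_toConf, Set.mem_empty_iff_false,
        iff_false, not_and, not_le]
      intro _
      simpa using hn
    simp [this]

/-! ### Integration of sums over finite sets -/

/-- Integration against `ν` of the sums `∑ i ∈ T y, f (g y i)` amounts to integration of `f`
against `ρ`. -/
structure SumTransfer {Y Z I : Type*} [MeasurableSpace Y] [MeasurableSpace Z] (ν : Measure Y)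
    (ρ : Measure Z) (T : Y → Finset I) (g : Y → I → Z) : Prop where
  measurable_real : ∀ f : Z → ℝ, Measurable f → Measurable fun y => ∑ i ∈ T y, f (g y i)
  measurable_ennreal : ∀ f : Z → ℝ≥0∞, Measurable f → Measurable fun y => ∑ i ∈ T y, f (g y i)
  lintegral_eq : ∀ f : Z → ℝ≥0∞, Measurable f →
    ∫⁻ y, ∑ i ∈ T y, f (g y i) ∂ν = ∫⁻ z, f z ∂ρ

namespace SumTransfer

variable {Y Z I : Type*} [MeasurableSpace Y] [MeasurableSpace Z] {ν : Measure Y} {ρ : Measure Z}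
  {T : Y → Finset I} {g : Y → I → Z}

theorem integrable (h : SumTransfer ν ρ T g) {f : Z → ℝ} (hf : Measurable f)
    (hi : Integrable f ρ) : Integrable (fun y => ∑ i ∈ T y, f (g y i)) ν := by
  refine ⟨(h.measurable_real f hf).aestronglyMeasurable, ?_⟩
  refine lt_of_le_of_lt (lintegral_mono fun y => enorm_sum_le _ _) ?_
  rw [h.lintegral_eq _ hf.enorm]
  exact hi.2

theorem integral_eq_of_nonneg (h : SumTransfer ν ρ T g) {f : Z → ℝ} (hf : Measurable f)
    (h0 : ∀ z, 0 ≤ f z) : ∫ y, ∑ i ∈ T y, f (g y i) ∂ν = ∫ z, f z ∂ρ := by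
  rw [integral_eq_lintegral_of_nonneg_ae
      (Filter.Eventually.of_forall fun y => Finset.sum_nonneg fun i _ => h0 _)
      (h.measurable_real f hf).aestronglyMeasurable,
    integral_eq_lintegral_of_nonneg_ae (Filter.Eventually.of_forall h0) hf.aestronglyMeasurable,
    ← h.lintegral_eq _ hf.ennreal_ofReal]
  simp only [ENNReal.ofReal_sum_of_nonneg fun i _ => h0 _]

theorem integral_eq (h : SumTransfer ν ρ T g) {f : Z → ℝ} (hf : Measurable f)
    (hi : Integrable f ρ) : ∫ y, ∑ i ∈ T y, f (g y i) ∂ν = ∫ z, f z ∂ρ := by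
  -- The parts are taken of `f` on `Z`, not of the sum over `T y`: only then are both halves again
  -- sums to which the nonnegative case applies.
  have e : ∀ r : ℝ, r = max r 0 - max (-r) 0 := fun r => by
    rcases le_total r 0 with hr | hr
    · rw [max_eq_right hr, max_eq_left (by linarith)]; ring
    · rw [max_eq_left hr, max_eq_right (by linarith)]; ring
  have m1 : Measurable fun z => max (f z) 0 := hf.max measurable_const
  have m2 : Measurable fun z => max (-f z) 0 := hf.neg.max measurable_const
  have i1 : Integrable (fun z => max (f z) 0) ρ := hi.pos_part
  have i2 : Integrable (fun z => max (-f z) 0) ρ := hi.neg_part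
  calc ∫ y, ∑ i ∈ T y, f (g y i) ∂ν
      = ∫ y, (∑ i ∈ T y, max (f (g y i)) 0 - ∑ i ∈ T y, max (-f (g y i)) 0) ∂ν := by
        refine integral_congr_ae (Filter.Eventually.of_forall fun y => ?_)
        simp only [← Finset.sum_sub_distrib, ← e]
    _ = ∫ z, (max (f z) 0 - max (-f z) 0) ∂ρ := by
        rw [integral_sub (h.integrable m1 i1) (h.integrable m2 i2), integral_sub i1 i2,
          h.integral_eq_of_nonneg m1 fun _ => le_max_right _ _,
          h.integral_eq_of_nonneg m2 fun _ => le_max_right _ _]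
    _ = ∫ z, f z ∂ρ := by simp only [← e]

/-- The number of indices that lead into a measurable null set `N` has integral `ρ N = 0`, so it is
zero almost everywhere. Statements about a generic splitting or a generic point thus hold for all
splittings or all points of a generic configuration. -/
theorem ae (h : SumTransfer ν ρ T g) {p : Z → Prop} (hp : ∀ᵐ z ∂ρ, p z) :
    ∀ᵐ y ∂ν, ∀ i ∈ T y, p (g y i) := by
  obtain ⟨N, hN, hNm, hN0⟩ := exists_measurable_superset_of_null hp
  have hm : Measurable (N.indicator (1 : Z → ℝ≥0∞)) := measurable_one.indicator hNm
  have h1 := h.lintegral_eq _ hm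
  rw [lintegral_indicator_one hNm, hN0, lintegral_eq_zero_iff (h.measurable_ennreal _ hm)] at h1
  filter_upwards [h1] with y hy i hi
  have := Finset.sum_eq_zero_iff.1 hy i hi
  by_contra hc
  have hmem : g y i ∈ N := hN hc
  simp [hmem] at this

end SumTransfer

theorem measurePreserving_prodProdProdComm {α β γ δ : Type*} [MeasurableSpace α]
    [MeasurableSpace β] [MeasurableSpace γ] [MeasurableSpace δ] (μa : Measure α) (μb : Measure β)
    (μc : Measure γ) (μd : Measure δ) [SFinite μa] [SFinite μb] [SFinite μc] [SFinite μd] :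
    MeasurePreserving (fun p : (α × β) × (γ × δ) => ((p.1.1, p.2.1), (p.1.2, p.2.2)))
      ((μa.prod μb).prod (μc.prod μd)) ((μa.prod μc).prod (μb.prod μd)) := by
  have h1 := measurePreserving_prodAssoc μa μb (μc.prod μd)
  have h2 := (measurePreserving_prodAssoc μb μc μd).symm
  have h3 := (Measure.measurePreserving_swap (μ := μb) (ν := μc)).prod (MeasurePreserving.id μd)
  have h4 := measurePreserving_prodAssoc μc μb μd
  have h5 := (measurePreserving_prodAssoc μa μc (μb.prod μd)).symm
  exact h5.comp (((MeasurePreserving.id μa).prod (h4.comp (h3.comp h2))).comp h1)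

/-! ### Two-component configurations as finite sets of marked points -/

/-- The point `x` with the mark `s`. -/
def mk (s : Bool) (x : E d) : E d ⊕ E d := if s then Sum.inl x else Sum.inr x

/-- The positions of the points with mark `s`. -/
def part (s : Bool) (D : Finset (E d ⊕ E d)) : Finset (E d) := if s then D.toLeft else D.toRight

theorem mem_part {s : Bool} {x : E d} {D : Finset (E d ⊕ E d)} : x ∈ part s D ↔ mk s x ∈ D := by
  cases s <;> simp [part, mk]

/-- The two components of a set of marked points. -/
def split (D : Finset (E d ⊕ E d)) : Conf d × Conf d := (⟨D.toLeft⟩, ⟨D.toRight⟩)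

/-- The set of marked points with given components. -/
def join (p : Conf d × Conf d) : Finset (E d ⊕ E d) := p.1.pts.disjSum p.2.pts

@[simp] theorem split_join (p : Conf d × Conf d) : split (join p) = p := by
  simp [split, join]

@[simp] theorem join_split (D : Finset (E d ⊕ E d)) : join (split D) = D :=
  Finset.toLeft_disjSum_toRight

/-- The σ-algebra on sets of marked points is that of pairs of configurations. -/
instance instMeasurableSpaceMarked (d : ℕ) : MeasurableSpace (Finset (E d ⊕ E d)) :=
  MeasurableSpace.comap split inferInstance

theorem measurable_split : Measurable (split : Finset (E d ⊕ E d) → _) :=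
  comap_measurable _

theorem measurable_marked_iff {α : Type*} [MeasurableSpace α] {g : α → Finset (E d ⊕ E d)} :
    Measurable g ↔ Measurable fun a => split (g a) :=
  measurable_comap_iff

@[fun_prop]
theorem measurable_join : Measurable (join : Conf d × Conf d → _) :=
  measurable_marked_iff.2 (by simpa using measurable_id')

theorem measurable_toLeft : Measurable fun D : Finset (E d ⊕ E d) => (⟨D.toLeft⟩ : Conf d) :=
  measurable_fst.comp measurable_split

theorem measurable_toRight : Measurable fun D : Finset (E d ⊕ E d) => (⟨D.toRight⟩ : Conf d) :=
  measurable_snd.comp measurable_split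

/-- The Lebesgue–Poisson measure on sets of marked points. -/
def markedLP (d : ℕ) : Measure (Finset (E d ⊕ E d)) :=
  ((lebPoisson d).prod (lebPoisson d)).map join

instance : SFinite (markedLP d) := by
  unfold markedLP
  infer_instance

theorem measurable_marked_union :
    Measurable fun p : Finset (E d ⊕ E d) × Finset (E d ⊕ E d) => p.1 ∪ p.2 := by
  refine measurable_marked_iff.2 ?_
  simp only [split, Finset.toLeft_union, Finset.toRight_union]
  exact (measurable_union.comp ((measurable_toLeft.comp measurable_fst).prodMk
      (measurable_toLeft.comp measurable_snd))).prodMk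
    (measurable_union.comp ((measurable_toRight.comp measurable_fst).prodMk
      (measurable_toRight.comp measurable_snd)))

theorem measurable_marked_insert (s : Bool) :
    Measurable fun p : E d × Finset (E d ⊕ E d) => insert (mk s p.1) p.2 := by
  refine measurable_marked_iff.2 ?_
  cases s
  · simp only [split, mk, Bool.false_eq_true, if_false, Finset.toLeft_insert_inr,
      Finset.toRight_insert_inr]
    exact (measurable_toLeft.comp measurable_snd).prodMk
      (measurable_insert.comp (measurable_fst.prodMk (measurable_toRight.comp measurable_snd)))
  · simp only [split, mk, if_true, Finset.toLeft_insert_inl, Finset.toRight_insert_inl]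
    exact (measurable_insert.comp
      (measurable_fst.prodMk (measurable_toLeft.comp measurable_snd))).prodMk
      (measurable_toRight.comp measurable_snd)

theorem sum_powerset_disjSum {α β γ : Type*} [AddCommMonoid γ] (a : Finset α) (b : Finset β)
    (f : Finset (α ⊕ β) → γ) :
    ∑ D ∈ (a.disjSum b).powerset, f D = ∑ A ∈ a.powerset, ∑ B ∈ b.powerset, f (A.disjSum B) := by
  rw [← Finset.sum_product']
  refine Finset.sum_nbij' (fun D => (D.toLeft, D.toRight)) (fun p => p.1.disjSum p.2) ?_ ?_ ?_ ?_ ?_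
  · intro D hD
    have := Finset.mem_powerset.1 hD
    have h1 := Finset.toLeft_subset_toLeft this
    have h2 := Finset.toRight_subset_toRight this
    rw [Finset.toLeft_disjSum] at h1
    rw [Finset.toRight_disjSum] at h2
    simpa using ⟨h1, h2⟩
  · rintro ⟨A, B⟩ h
    simp only [Finset.mem_product, Finset.mem_powerset] at h
    exact Finset.mem_powerset.2 (Finset.disjSum_mono h.1 h.2)
  · intro D _
    exact Finset.toLeft_disjSum_toRight
  · rintro ⟨A, B⟩ _
    simp
  · intro D _
    rw [Finset.toLeft_disjSum_toRight]

theorem sum_marked_powerset {β : Type*} [AddCommMonoid β] (p : Conf d × Conf d)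
    (f : Finset (E d ⊕ E d) → Finset (E d ⊕ E d) → β) :
    ∑ A ∈ (join p).powerset, f A (join p \ A) = ∑ A ∈ p.1.pts.powerset, ∑ B ∈ p.2.pts.powerset,
      f (join (⟨A⟩, ⟨B⟩)) (join (⟨p.1.pts \ A⟩, ⟨p.2.pts \ B⟩)) := by
  rw [join, sum_powerset_disjSum]
  refine Finset.sum_congr rfl fun A _ => Finset.sum_congr rfl fun B _ => ?_
  congr 1
  ext (x | x) <;> simp [join]

theorem measurable_sum_marked_powerset {α β : Type*} [MeasurableSpace α] [AddCommMonoid β]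
    [MeasurableSpace β] [MeasurableAdd₂ β]
    {f : Finset (E d ⊕ E d) → Finset (E d ⊕ E d) → α → β}
    (hf : Measurable fun q : Finset (E d ⊕ E d) × Finset (E d ⊕ E d) × α => f q.1 q.2.1 q.2.2)
    {D : α → Finset (E d ⊕ E d)} (hD : Measurable D) :
    Measurable fun y => ∑ A ∈ (D y).powerset, f A (D y \ A) y := by
  have hL : Measurable fun y => (⟨(D y).toLeft⟩ : Conf d) := measurable_toLeft.comp hD
  have hR : Measurable fun y => (⟨(D y).toRight⟩ : Conf d) := measurable_toRight.comp hD
  have h1 : Measurable fun q : Conf d × Conf d × α => ∑ B ∈ (D q.2.2).toRight.powerset,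
      f (join (q.1, ⟨B⟩)) (join (q.2.1, ⟨(D q.2.2).toRight \ B⟩)) q.2.2 := by
    refine measurable_sum_powerset
      (f := fun b b' (q : Conf d × Conf d × α) => f (join (q.1, b)) (join (q.2.1, b')) q.2.2)
      (a := fun q => ⟨(D q.2.2).toRight⟩) ?_ (hR.comp (measurable_snd.comp measurable_snd))
    exact hf.comp (g := fun q => f q.1 q.2.1 q.2.2)
      (f := fun q : Conf d × Conf d × Conf d × Conf d × α =>
        (join (q.2.2.1, q.1), join (q.2.2.2.1, q.2.1), q.2.2.2.2)) (by fun_prop)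
  have h2 := measurable_sum_powerset (f := fun a a' y => ∑ B ∈ (D y).toRight.powerset,
      f (join (a, ⟨B⟩)) (join (a', ⟨(D y).toRight \ B⟩)) y) h1
      (a := fun y => ⟨(D y).toLeft⟩) hL
  convert h2 using 2 with y
  have := sum_marked_powerset (split (D y)) fun A B => f A B y
  rw [join_split] at this
  exact this

theorem sum_part_erase {β : Type*} [AddCommMonoid β] (p : Conf d × Conf d) (s : Bool)
    (f : E d → Finset (E d ⊕ E d) → β) :
    ∑ x ∈ part s (join p), f x ((join p).erase (mk s x)) =
      if s then ∑ x ∈ p.1.pts, f x (join (⟨p.1.pts.erase x⟩, p.2))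
      else ∑ x ∈ p.2.pts, f x (join (p.1, ⟨p.2.pts.erase x⟩)) := by
  cases s
  · simp only [part, join, Bool.false_eq_true, if_false, Finset.toRight_disjSum, mk]
    refine Finset.sum_congr rfl fun x _ => ?_
    congr 1
    ext (y | y) <;> simp
  · simp only [part, join, if_true, Finset.toLeft_disjSum, mk]
    refine Finset.sum_congr rfl fun x _ => ?_
    congr 1
    ext (y | y) <;> simp

theorem measurable_sum_part_erase {α β : Type*} [MeasurableSpace α] [AddCommMonoid β]
    [MeasurableSpace β] [MeasurableAdd₂ β] (s : Bool)
    {f : E d → Finset (E d ⊕ E d) → α → β}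
    (hf : Measurable fun q : E d × Finset (E d ⊕ E d) × α => f q.1 q.2.1 q.2.2)
    {D : α → Finset (E d ⊕ E d)} (hD : Measurable D) :
    Measurable fun y => ∑ x ∈ part s (D y), f x ((D y).erase (mk s x)) y := by
  have hL : Measurable fun y => (⟨(D y).toLeft⟩ : Conf d) := measurable_toLeft.comp hD
  have hR : Measurable fun y => (⟨(D y).toRight⟩ : Conf d) := measurable_toRight.comp hD
  have key : ∀ y, ∑ x ∈ part s (D y), f x ((D y).erase (mk s x)) y =
      if s then ∑ x ∈ (D y).toLeft, f x (join (⟨(D y).toLeft.erase x⟩, ⟨(D y).toRight⟩)) y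
      else ∑ x ∈ (D y).toRight, f x (join (⟨(D y).toLeft⟩, ⟨(D y).toRight.erase x⟩)) y := by
    intro y
    have := sum_part_erase (split (D y)) s fun x B => f x B y
    rw [join_split] at this
    exact this
  simp only [key]
  cases s
  · refine measurable_sum_erase (f := fun x b y => f x (join (⟨(D y).toLeft⟩, b)) y)
      (a := fun y => ⟨(D y).toRight⟩) ?_ hR
    exact hf.comp (g := fun q => f q.1 q.2.1 q.2.2)
      (f := fun q : E d × Conf d × α => (q.1, join (⟨(D q.2.2).toLeft⟩, q.2.1), q.2.2))
      (measurable_fst.prodMk ((measurable_join.comp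
        ((hL.comp (measurable_snd.comp measurable_snd)).prodMk
          (measurable_fst.comp measurable_snd))).prodMk (measurable_snd.comp measurable_snd)))
  · refine measurable_sum_erase (f := fun x b y => f x (join (b, ⟨(D y).toRight⟩)) y)
      (a := fun y => ⟨(D y).toLeft⟩) ?_ hL
    exact hf.comp (g := fun q => f q.1 q.2.1 q.2.2)
      (f := fun q : E d × Conf d × α => (q.1, join (q.2.1, ⟨(D q.2.2).toRight⟩), q.2.2))
      (measurable_fst.prodMk ((measurable_join.comp
        ((measurable_fst.comp measurable_snd).prodMk
          (hR.comp (measurable_snd.comp measurable_snd)))).prodMk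
        (measurable_snd.comp measurable_snd)))

theorem lintegral_markedLP {f : Finset (E d ⊕ E d) → ℝ≥0∞} (hf : Measurable f) :
    ∫⁻ D, f D ∂markedLP d = ∫⁻ p, f (join p) ∂(lebPoisson d).prod (lebPoisson d) := by
  rw [markedLP, lintegral_map hf measurable_join]

/-- Integration of a sum over all splittings of a configuration. -/
theorem sumTransfer_powerset (hd : 0 < d) :
    SumTransfer (markedLP d) ((markedLP d).prod (markedLP d)) Finset.powerset
      fun D A => (A, D \ A) := by
  have hm : ∀ {β : Type} [AddCommMonoid β] [MeasurableSpace β] [MeasurableAdd₂ β]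
      (f : Finset (E d ⊕ E d) × Finset (E d ⊕ E d) → β), Measurable f →
      Measurable fun D => ∑ A ∈ D.powerset, f (A, D \ A) := fun f hf =>
    measurable_sum_marked_powerset (f := fun A B _ => f (A, B)) (by fun_prop) measurable_id
  refine ⟨fun f hf => hm f hf, fun f hf => hm f hf, fun f hf => ?_⟩
  let lam := lebPoisson d
  have hF : Measurable fun q : (Conf d × Conf d) × (Conf d × Conf d) =>
      f (join (q.1.1, q.2.1), join (q.1.2, q.2.2)) :=
    hf.comp ((measurable_join.comp (by fun_prop)).prodMk (measurable_join.comp (by fun_prop)))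
  have hG : Measurable fun r : Conf d × Conf d =>
      ∫⁻ q, f (join (r.1, q.1), join (r.2, q.2)) ∂lam.prod lam :=
    Measurable.lintegral_prod_right' hF
  rw [lintegral_markedLP (hm f hf)]
  simp only [sum_marked_powerset _ fun A B => f (A, B)]
  have hL : Measurable fun p : Conf d × Conf d => ∑ A ∈ p.1.pts.powerset,
      ∑ B ∈ p.2.pts.powerset,
        f (join (⟨A⟩, ⟨B⟩), join (⟨p.1.pts \ A⟩, ⟨p.2.pts \ B⟩)) := by
    have := (hm f hf).comp measurable_join
    simp only [Function.comp_def, sum_marked_powerset _ fun A B => f (A, B)] at this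
    exact this
  have hB : ∀ A A' : Conf d, Measurable fun b : Conf d => ∑ B ∈ b.pts.powerset,
      f (join (A, ⟨B⟩), join (A', ⟨b.pts \ B⟩)) := fun A A' =>
    measurable_sum_powerset (f := fun b b' _ => f (join (A, b), join (A', b'))) (by fun_prop)
      measurable_id
  -- The one-component splitting formula is applied to the second component with the first one
  -- fixed, then to the first. It remains to regroup the four factors from components into parts.
  rw [lintegral_prod _ hL.aemeasurable]
  have h1 : ∀ a : Conf d, ∫⁻ b, ∑ A ∈ a.pts.powerset, ∑ B ∈ b.pts.powerset,
      f (join (⟨A⟩, ⟨B⟩), join (⟨a.pts \ A⟩, ⟨b.pts \ B⟩)) ∂lam =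
      ∑ A ∈ a.pts.powerset, ∫⁻ q,
        f (join (⟨A⟩, q.1), join (⟨a.pts \ A⟩, q.2)) ∂lam.prod lam := by
    intro a
    rw [lintegral_finsetSum _ fun A _ => hB ⟨A⟩ ⟨a.pts \ A⟩]
    refine Finset.sum_congr rfl fun A _ => ?_
    exact lintegral_sum_powerset hd
      (f := fun q => f (join (⟨A⟩, q.1), join (⟨a.pts \ A⟩, q.2))) (by fun_prop)
  rw [lintegral_congr h1, lintegral_sum_powerset hd hG]
  have h2 := (measurePreserving_prodProdProdComm lam lam lam lam).lintegral_comp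
    (f := fun q => f (join q.1, join q.2)) (hf.comp ((measurable_join.comp measurable_fst).prodMk
      (measurable_join.comp measurable_snd)))
  rw [← lintegral_prod _ hF.aemeasurable]
  refine h2.trans ?_
  rw [markedLP, Measure.map_prod_map _ _ measurable_join measurable_join,
    lintegral_map hf (measurable_join.prodMap measurable_join)]
  rfl

/-- The Mecke formula for points with the mark `s`. -/
theorem sumTransfer_part (hd : 0 < d) (s : Bool) :
    SumTransfer (markedLP d) ((markedLP d).prod volume) (part s)
      fun D x => (D.erase (mk s x), x) := by
  have hm : ∀ {β : Type} [AddCommMonoid β] [MeasurableSpace β] [MeasurableAdd₂ β]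
      (f : Finset (E d ⊕ E d) × E d → β), Measurable f →
      Measurable fun D => ∑ x ∈ part s D, f (D.erase (mk s x), x) := fun f hf =>
    measurable_sum_part_erase s (f := fun x D _ => f (D, x)) (by fun_prop) measurable_id
  refine ⟨fun f hf => hm f hf, fun f hf => hm f hf, fun f hf => ?_⟩
  let lam := lebPoisson d
  have hr : ∫⁻ z, f z ∂(markedLP d).prod volume =
      ∫⁻ x, ∫⁻ p, f (join p, x) ∂lam.prod lam := by
    rw [lintegral_prod_symm' _ hf]
    exact lintegral_congr fun x => lintegral_markedLP (f := fun D => f (D, x))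
      (hf.comp (by fun_prop))
  have hL := (hm f hf).comp measurable_join
  rw [hr, lintegral_markedLP (hm f hf)]
  simp only [Function.comp_def, sum_part_erase _ s fun x D => f (D, x)] at hL ⊢
  have hJ : Measurable fun q : (E d × Conf d) × Conf d => f (join (q.1.2, q.2), q.1.1) :=
    hf.comp ((measurable_join.comp (by fun_prop)).prodMk (by fun_prop))
  have hJ' : Measurable fun q : (E d × Conf d) × Conf d => f (join (q.2, q.1.2), q.1.1) :=
    hf.comp ((measurable_join.comp (by fun_prop)).prodMk (by fun_prop))
  cases s
  · simp only [Bool.false_eq_true, if_false] at hL ⊢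
    rw [lintegral_prod _ hL.aemeasurable]
    have h1 : ∀ a : Conf d, ∫⁻ b, ∑ x ∈ b.pts, f (join (a, ⟨b.pts.erase x⟩), x) ∂lam =
        ∫⁻ q, f (join (a, q.2), q.1) ∂(volume : Measure (E d)).prod lam := fun a =>
      lintegral_sum_erase hd (f := fun q => f (join (a, q.2), q.1))
        (hJ'.comp (f := fun q => (q, a)) (by fun_prop))
    rw [lintegral_congr h1, lintegral_lintegral_swap, lintegral_prod]
    · refine lintegral_congr fun x => ?_
      have hx : Measurable fun p : Conf d × Conf d => f (join p, x) := by fun_prop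
      rw [lintegral_prod_symm' _ hx]
    · exact (Measurable.lintegral_prod_right' hJ').aemeasurable
    · exact (hJ'.comp measurable_swap).aemeasurable
  · simp only [if_true] at hL ⊢
    rw [lintegral_prod_symm' _ hL]
    have h1 : ∀ b : Conf d, ∫⁻ a, ∑ x ∈ a.pts, f (join (⟨a.pts.erase x⟩, b), x) ∂lam =
        ∫⁻ q, f (join (q.2, b), q.1) ∂(volume : Measure (E d)).prod lam := fun b =>
      lintegral_sum_erase hd (f := fun q => f (join (q.2, b), q.1))
        (hJ.comp (f := fun q => (q, b)) (by fun_prop))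
    rw [lintegral_congr h1, lintegral_lintegral_swap, lintegral_prod]
    · refine lintegral_congr fun x => ?_
      have hx : Measurable fun p : Conf d × Conf d => f (join p, x) := by fun_prop
      rw [lintegral_prod _ hx.aemeasurable]
    · exact (Measurable.lintegral_prod_right' hJ).aemeasurable
    · exact (hJ.comp measurable_swap).aemeasurable

/-- Integration of a sum over all splittings of a configuration with a distinguished point with
mark `s` in the first part. -/
theorem sumTransfer_pointed (hd : 0 < d) (s : Bool) :
    SumTransfer (markedLP d) (((markedLP d).prod volume).prod (markedLP d))
      (fun D => D.powerset.sigma fun A => part s A)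
      fun D i => ((i.1.erase (mk s i.2), i.2), D \ i.1) := by
  have hg : ∀ {β : Type} [AddCommMonoid β] [MeasurableSpace β] [MeasurableAdd₂ β]
      (f : (Finset (E d ⊕ E d) × E d) × Finset (E d ⊕ E d) → β), Measurable f →
      Measurable fun p : Finset (E d ⊕ E d) × Finset (E d ⊕ E d) =>
        ∑ x ∈ part s p.1, f ((p.1.erase (mk s x), x), p.2) := fun f hf =>
    measurable_sum_part_erase s (f := fun x D p => f ((D, x), p.2)) (by fun_prop) measurable_fst
  refine ⟨fun f hf => ?_, fun f hf => ?_, fun f hf => ?_⟩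
  · simp only [Finset.sum_sigma]
    exact (sumTransfer_powerset hd).measurable_real _ (hg f hf)
  · simp only [Finset.sum_sigma]
    exact (sumTransfer_powerset hd).measurable_ennreal _ (hg f hf)
  · simp only [Finset.sum_sigma]
    -- First D is split into two independent parts; then, with the second part fixed, the Mecke
    -- formula takes the distinguished point out of the first.
    rw [(sumTransfer_powerset hd).lintegral_eq _ (hg f hf), lintegral_prod_symm' _ (hg f hf),
      lintegral_prod_symm' _ hf]
    exact lintegral_congr fun ζ => (sumTransfer_part hd s).lintegral_eq (fun q => f (q, ζ))
      (hf.comp (by fun_prop))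

theorem ae_mk_notMem (hd : 0 < d) (p : E d ⊕ E d) : ∀ᵐ D ∂markedLP d, p ∉ D := by
  have hm : MeasurableSet {D : Finset (E d ⊕ E d) | p ∉ D} := by
    rcases p with x | x
    · have : {D : Finset (E d ⊕ E d) | Sum.inl x ∉ D} =
          (fun D => (x, (⟨D.toLeft⟩ : Conf d))) ⁻¹' {p : E d × Conf d | p.1 ∈ p.2.pts}ᶜ := by
        ext D
        simp
      rw [this]
      exact (measurable_const.prodMk measurable_toLeft) measurableSet_mem.compl
    · have : {D : Finset (E d ⊕ E d) | Sum.inr x ∉ D} =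
          (fun D => (x, (⟨D.toRight⟩ : Conf d))) ⁻¹' {p : E d × Conf d | p.1 ∈ p.2.pts}ᶜ := by
        ext D
        simp
      rw [this]
      exact (measurable_const.prodMk measurable_toRight) measurableSet_mem.compl
  rw [markedLP, ae_map_iff measurable_join.aemeasurable hm]
  rcases p with x | x
  · filter_upwards [Measure.quasiMeasurePreserving_fst.ae (ae_notMem hd x)] with q hq
    simpa [join] using hq
  · filter_upwards [Measure.quasiMeasurePreserving_snd.ae (ae_notMem hd x)] with q hq
    simpa [join] using hq

/-- For a fixed finite first component, each of its points is avoided by almost every second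
component. Restricting λ ⊗ λ to Γ₀² therefore loses no mass. -/
theorem ae_disjoint (hd : 0 < d) :
    ∀ᵐ p ∂(lebPoisson d).prod (lebPoisson d), Disjoint p.1.pts p.2.pts := by
  refine (Measure.ae_prod_iff_ae_ae (measurableSet_disjoint d)).2 ?_
  refine Filter.Eventually.of_forall fun a => ?_
  have : ∀ᵐ b ∂lebPoisson d, ∀ x ∈ a.pts, x ∉ b.pts := by
    rw [Filter.eventually_all_finset]
    exact fun x _ => ae_notMem hd x
  filter_upwards [this] with b hb
  exact Finset.disjoint_left.2 hb

/-! ### Hops of marked points -/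

/-- Finite sets of marked points. -/
abbrev Marked (d : ℕ) : Type := Finset (E d ⊕ E d)

/-- The inverse `K`-transform `(K⁻¹ c(x, y, · ∪ ξ))(ζ)` of a rate of marked configurations. -/
def kern (c : E d → E d → Marked d → ℝ) (x y : E d) (ξ ζ : Marked d) : ℝ :=
  ∑ A ∈ ζ.powerset, (-1 : ℝ) ^ (ζ \ A).card * c x y (A ∪ ξ)

/-- The `K`-transform on sets of marked points, cut off to sets with disjoint components. -/
def markedKT (g : Marked d → ℝ) (D : Marked d) : ℝ :=
  if Disjoint D.toLeft D.toRight then ∑ A ∈ D.powerset, g A else 0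

/-- The generator of hops from points with mark `s` to points with mark `t`. -/
def hop (s t : Bool) (c : E d → E d → Marked d → ℝ) (F : Marked d → ℝ) (D : Marked d) : ℝ :=
  ∑ x ∈ part s D, ∫ y, c x y (D.erase (mk s x)) *
    (F (insert (mk t y) (D.erase (mk s x))) - F D)

/-- The operator `K⁻¹ L K` for the generator `L` of hops. -/
def hopHat (s t : Bool) (c : E d → E d → Marked d → ℝ) (g : Marked d → ℝ) (η : Marked d) : ℝ :=
  ∑ D ∈ η.powerset, (-1 : ℝ) ^ (η \ D).card * hop s t c (markedKT g) D

/-- The dual of the operator `K⁻¹ L K` for the generator `L` of hops. -/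
def hopDual (s t : Bool) (c : E d → E d → Marked d → ℝ) (k : Marked d → ℝ) (η : Marked d) : ℝ :=
  (∑ y ∈ part t η, ∫ ζ, ∫ x, k ((ζ ∪ η ∪ {mk s x}) \ {mk t y}) *
      kern c x y (η.erase (mk t y)) ζ ∂volume ∂markedLP d) -
  ∑ x ∈ part s η, ∫ ζ, k (ζ ∪ η) * ∫ y, kern c x y (η.erase (mk s x)) ζ ∂volume ∂markedLP d

/-- Nonnegative measurable rates of marked configurations. -/
structure IsMarkedRate (c : E d → E d → Marked d → ℝ) : Prop where
  measurable : Measurable fun p : E d × E d × Marked d => c p.1 p.2.1 p.2.2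
  nonneg : ∀ x y D, 0 ≤ c x y D

/-- A set of configurations of bounded size that contains the subsets of its members, has finite
measure, and on which the total rate of hops is integrable. -/
structure IsCutoff (s : Bool) (c : E d → E d → Marked d → ℝ) (B : Set (Marked d)) (N : ℕ) :
    Prop where
  measurableSet : MeasurableSet B
  mem_of_subset : ∀ D ∈ B, ∀ A ⊆ D, A ∈ B
  card_le : ∀ D ∈ B, D.card ≤ N
  measure_lt_top : markedLP d B < ⊤
  rate_lt_top : ∫⁻ D in B, (∑ x ∈ part s D, ∫⁻ y, ENNReal.ofReal (c x y (D.erase (mk s x))))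
    ∂markedLP d < ⊤

section measurability

variable {α : Type*} [MeasurableSpace α]

theorem _root_.Measurable.marked_insert (s : Bool) {x : α → E d} {D : α → Marked d}
    (hx : Measurable x) (hD : Measurable D) : Measurable fun a => insert (mk s (x a)) (D a) :=
  (measurable_marked_insert s).comp (hx.prodMk hD)

theorem _root_.Measurable.marked_union {A D : α → Marked d}
    (hA : Measurable A) (hD : Measurable D) : Measurable fun a => A a ∪ D a :=
  measurable_marked_union.comp (hA.prodMk hD)

theorem measurable_marked_card : Measurable fun D : Marked d => D.card := by
  have : (fun D : Marked d => D.card) = fun D => D.toLeft.card + D.toRight.card := by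
    ext D
    rw [Finset.card_toLeft_add_card_toRight]
  rw [this]
  exact (measurable_card.comp measurable_toLeft).add (measurable_card.comp measurable_toRight)

theorem IsMarkedRate.measurable_comp {c : E d → E d → Marked d → ℝ} (hc : IsMarkedRate c)
    {x y : α → E d} {D : α → Marked d} (hx : Measurable x) (hy : Measurable y)
    (hD : Measurable D) : Measurable fun a => c (x a) (y a) (D a) :=
  hc.measurable.comp (hx.prodMk (hy.prodMk hD))

theorem measurable_kern {c : E d → E d → Marked d → ℝ} (hc : IsMarkedRate c)
    {x y : α → E d} {ξ ζ : α → Marked d} (hx : Measurable x) (hy : Measurable y)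
    (hξ : Measurable ξ) (hζ : Measurable ζ) :
    Measurable fun a => kern c (x a) (y a) (ξ a) (ζ a) := by
  refine measurable_sum_marked_powerset
    (f := fun A A' a => (-1 : ℝ) ^ A'.card * c (x a) (y a) (A ∪ ξ a)) (Measurable.mul ?_ ?_) hζ
  · exact (measurable_from_nat (f := fun n => (-1 : ℝ) ^ n)).comp
      (measurable_marked_card.comp (measurable_fst.comp measurable_snd))
  · have h2 : Measurable fun q : Marked d × Marked d × α => q.2.2 :=
      measurable_snd.comp measurable_snd
    exact hc.measurable_comp (hx.comp h2) (hy.comp h2)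
      (measurable_fst.marked_union (hξ.comp h2))

theorem IsMarkedRate.measurable_lintegral {c : E d → E d → Marked d → ℝ} (hc : IsMarkedRate c)
    {x : α → E d} {D : α → Marked d} (hx : Measurable x) (hD : Measurable D) :
    Measurable fun a => ∫⁻ y, ENNReal.ofReal (c (x a) y (D a)) := by
  refine Measurable.lintegral_prod_right' (f := fun p : α × E d =>
    ENNReal.ofReal (c (x p.1) p.2 (D p.1))) ?_
  exact (hc.measurable_comp (hx.comp measurable_fst) measurable_snd
    (hD.comp measurable_fst)).ennreal_ofReal

end measurability

/-! ### Absolute integrability from the total jump rates -/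

theorem abs_kern_le {c : E d → E d → Marked d → ℝ} (hc : IsMarkedRate c) (x y : E d)
    (ξ ζ : Marked d) : |kern c x y ξ ζ| ≤ ∑ A ∈ ζ.powerset, c x y (A ∪ ξ) := by
  refine (Finset.abs_sum_le_sum_abs _ _).trans_eq (Finset.sum_congr rfl fun A _ => ?_)
  rw [abs_mul, abs_pow, abs_neg, abs_one, one_pow, one_mul, abs_of_nonneg (hc.nonneg _ _ _)]

theorem lintegral_abs_kern_le {c : E d → E d → Marked d → ℝ} (hc : IsMarkedRate c) (x : E d)
    (ξ ζ : Marked d) : ∫⁻ y, ‖kern c x y ξ ζ‖ₑ ≤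
      ∑ A ∈ ζ.powerset, ∫⁻ y, ENNReal.ofReal (c x y (A ∪ ξ)) := by
  have hm : ∀ A ∈ ζ.powerset, Measurable fun y => ENNReal.ofReal (c x y (A ∪ ξ)) := fun A _ =>
    (hc.measurable_comp measurable_const measurable_id measurable_const).ennreal_ofReal
  rw [← lintegral_finsetSum _ hm]
  refine lintegral_mono fun y => ?_
  rw [Real.enorm_eq_ofReal_abs, ← ENNReal.ofReal_sum_of_nonneg fun A _ => hc.nonneg _ _ _]
  exact ENNReal.ofReal_le_ofReal (abs_kern_le hc x y ξ ζ)

/-- For fixed ξ, the point x lies in ξ and A is disjoint from ξ, so A ∪ (ξ∖x) = (A∪ξ)∖x. Since A ↦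
A∪ξ is injective, the inner sums form part of the sum over all subsets of D. The power of 2 counts
the sets ξ. -/
theorem sum_pointed_le (s : Bool) (r : E d → Marked d → ℝ≥0∞) (D : Marked d) :
    ∑ ξ ∈ D.powerset, ∑ x ∈ part s ξ, ∑ A ∈ (D \ ξ).powerset, r x (A ∪ ξ.erase (mk s x)) ≤
      2 ^ D.card * ∑ A ∈ D.powerset, ∑ x ∈ part s A, r x (A.erase (mk s x)) := by
  have key : ∀ ξ ∈ D.powerset,
      ∑ x ∈ part s ξ, ∑ A ∈ (D \ ξ).powerset, r x (A ∪ ξ.erase (mk s x)) ≤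
        ∑ A ∈ D.powerset, ∑ x ∈ part s A, r x (A.erase (mk s x)) := by
    intro ξ hξ
    rw [Finset.sum_comm]
    have hdis : ∀ A ∈ (D \ ξ).powerset, Disjoint A ξ := fun A hA =>
      Finset.disjoint_of_subset_left (Finset.mem_powerset.1 hA) Finset.sdiff_disjoint
    calc ∑ A ∈ (D \ ξ).powerset, ∑ x ∈ part s ξ, r x (A ∪ ξ.erase (mk s x))
        ≤ ∑ A ∈ (D \ ξ).powerset, ∑ x ∈ part s (A ∪ ξ), r x ((A ∪ ξ).erase (mk s x)) := by
          refine Finset.sum_le_sum fun A hA => ?_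
          refine le_trans (le_of_eq (Finset.sum_congr rfl fun x hx => ?_))
            (Finset.sum_le_sum_of_subset (s := part s ξ) fun x hx => ?_)
          · have : mk s x ∉ A := Finset.disjoint_right.1 (hdis A hA) (mem_part.1 hx)
            rw [Finset.erase_union_distrib, Finset.erase_eq_of_notMem this]
          · exact mem_part.2 (Finset.mem_union_right _ (mem_part.1 hx))
      _ = ∑ A ∈ (D \ ξ).powerset.image (· ∪ ξ), ∑ x ∈ part s A, r x (A.erase (mk s x)) := by
          rw [Finset.sum_image]
          intro A hA A' hA' h
          have h' : A ∪ ξ = A' ∪ ξ := h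
          rw [← Finset.union_sdiff_cancel_right (hdis A hA), h',
            Finset.union_sdiff_cancel_right (hdis A' hA')]
      _ ≤ _ := by
          refine Finset.sum_le_sum_of_subset fun A hA => ?_
          obtain ⟨A', hA', rfl⟩ := Finset.mem_image.1 hA
          refine Finset.mem_powerset.2 (Finset.union_subset ?_ (Finset.mem_powerset.1 hξ))
          exact (Finset.mem_powerset.1 hA').trans Finset.sdiff_subset
  refine (Finset.sum_le_sum key).trans_eq ?_
  rw [Finset.sum_const, Finset.card_powerset, nsmul_eq_mul]
  push_cast
  rfl

/-- The integrand common to both parts of the dual of a hop operator, as a function of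
`((ξ, x), (ζ, y))`. -/
def dualIntegrand (s : Bool) (c : E d → E d → Marked d → ℝ) (k : Marked d → ℝ)
    (p : (Marked d × E d) × (Marked d × E d)) : ℝ :=
  k (insert (mk s p.1.2) p.1.1 ∪ p.2.1) * kern c p.1.2 p.2.2 p.1.1 p.2.1

theorem measurable_dualIntegrand (s : Bool) {c : E d → E d → Marked d → ℝ} (hc : IsMarkedRate c)
    {k : Marked d → ℝ} (hk : Measurable k) : Measurable (dualIntegrand s c k) :=
  (hk.comp (((measurable_snd.comp measurable_fst).marked_insert s
    (measurable_fst.comp measurable_fst)).marked_union (measurable_fst.comp measurable_snd))).mul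
    (measurable_kern hc (measurable_snd.comp measurable_fst) (measurable_snd.comp measurable_snd)
      (measurable_fst.comp measurable_fst) (measurable_fst.comp measurable_snd))

/-- Integrating y out of the kernel leaves total rates. The pointed splitting formula, used
backwards, gathers ξ, x and ζ into one configuration D ∈ B, where `sum_pointed_le` bounds the
integrand by a sum over subsets of D. Used forwards, the plain splitting formula then bounds
everything by M · 2^N · (∫_B total rate) · λ(B). -/
theorem integrable_dualIntegrand (hd : 0 < d) {s : Bool} {c : E d → E d → Marked d → ℝ}
    (hc : IsMarkedRate c) {B : Set (Marked d)} {N : ℕ} (hB : IsCutoff s c B N)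
    {k : Marked d → ℝ} (hk : Measurable k) {M : ℝ} (hM : ∀ D, |k D| ≤ M)
    (h0 : ∀ D, D ∉ B → k D = 0) :
    Integrable (dualIntegrand s c k)
      (((markedLP d).prod volume).prod ((markedLP d).prod volume)) := by
  have hm := measurable_dualIntegrand s hc hk
  refine ⟨hm.aestronglyMeasurable, ?_⟩
  let r : E d → Marked d → ℝ≥0∞ := fun x D => ∫⁻ y, ENNReal.ofReal (c x y D)
  have hr : ∀ {α : Type} [MeasurableSpace α] {x : α → E d} {D : α → Marked d}, Measurable x →
      Measurable D → Measurable fun a => r (x a) (D a) := fun hx hD =>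
    hc.measurable_lintegral hx hD
  let R : Marked d → ℝ≥0∞ := fun D => ∑ x ∈ part s D, r x (D.erase (mk s x))
  have hR : Measurable R :=
    (sumTransfer_part hd s).measurable_ennreal (fun q => r q.2 q.1) (hr measurable_snd measurable_fst)
  let b : Marked d → ℝ≥0∞ := B.indicator 1
  have hb : Measurable b := measurable_one.indicator hB.measurableSet
  let h : (Marked d × E d) × Marked d → ℝ≥0∞ := fun q =>
    b (insert (mk s q.1.2) q.1.1 ∪ q.2) * ∑ A ∈ q.2.powerset, r q.1.2 (A ∪ q.1.1)
  have hh : Measurable h := by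
    refine Measurable.mul (hb.comp (((measurable_snd.comp measurable_fst).marked_insert s
      (measurable_fst.comp measurable_fst)).marked_union measurable_snd)) ?_
    refine measurable_sum_marked_powerset
      (f := fun A _ (q : (Marked d × E d) × Marked d) => r q.1.2 (A ∪ q.1.1)) ?_ measurable_snd
    exact hr (by fun_prop) (measurable_fst.marked_union (by fun_prop))
  have hkb : ∀ D, ‖k D‖ₑ ≤ ENNReal.ofReal M * b D := by
    intro D
    by_cases hD : D ∈ B
    · simp only [b, Set.indicator_of_mem hD, Pi.one_apply, mul_one, Real.enorm_eq_ofReal_abs]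
      exact ENNReal.ofReal_le_ofReal (hM D)
    · simp [h0 D hD]
  have step1 : ∫⁻ p, ‖dualIntegrand s c k p‖ₑ
      ∂((markedLP d).prod volume).prod ((markedLP d).prod volume) ≤
      ENNReal.ofReal M * ∫⁻ q, h q ∂((markedLP d).prod volume).prod (markedLP d) := by
    rw [← lintegral_const_mul _ hh, lintegral_prod _ hm.enorm.aemeasurable,
      lintegral_prod _ (hh.const_mul _).aemeasurable]
    refine lintegral_mono fun p => ?_
    have hmp : Measurable fun q => ‖dualIntegrand s c k (p, q)‖ₑ :=
      hm.enorm.comp measurable_prodMk_left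
    rw [lintegral_prod _ hmp.aemeasurable]
    refine lintegral_mono fun ζ => ?_
    simp only [dualIntegrand, enorm_mul]
    have hmk : Measurable fun y => ‖kern c p.2 y p.1 ζ‖ₑ :=
      (measurable_kern hc measurable_const measurable_id measurable_const measurable_const).enorm
    rw [lintegral_const_mul _ hmk, ← mul_assoc]
    exact mul_le_mul' (hkb _) (lintegral_abs_kern_le hc _ _ _)
  have step2 : ∫⁻ q, h q ∂((markedLP d).prod volume).prod (markedLP d) ≤
      2 ^ N * ∫⁻ p, b p.1 * R p.1 * b p.2 ∂(markedLP d).prod (markedLP d) := by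
    have hm2 : Measurable fun p : Marked d × Marked d => b p.1 * R p.1 * b p.2 := by fun_prop
    rw [← (sumTransfer_pointed hd s).lintegral_eq h hh, ← lintegral_const_mul _ hm2,
      ← (sumTransfer_powerset hd).lintegral_eq _ (hm2.const_mul _)]
    refine lintegral_mono fun D => ?_
    rw [Finset.sum_sigma]
    by_cases hD : D ∈ B
    -- Since B contains the subsets of its members, both parts of a splitting of D lie in B; this
    -- separates the bound into a product of two finite factors.
    · have hsub : ∀ A ∈ D.powerset, b A = 1 := fun A hA =>
        Set.indicator_of_mem (hB.mem_of_subset D hD A (Finset.mem_powerset.1 hA)) _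
      calc _ = ∑ ξ ∈ D.powerset, ∑ x ∈ part s ξ, ∑ A ∈ (D \ ξ).powerset,
            r x (A ∪ ξ.erase (mk s x)) := by
            refine Finset.sum_congr rfl fun ξ hξ => Finset.sum_congr rfl fun x hx => ?_
            simp only [h]
            rw [Finset.insert_erase (mem_part.1 hx),
              Finset.union_sdiff_of_subset (Finset.mem_powerset.1 hξ),
              hsub D (Finset.mem_powerset_self D), one_mul]
        _ ≤ 2 ^ D.card * ∑ A ∈ D.powerset, R A := sum_pointed_le s r D
        _ ≤ 2 ^ N * ∑ A ∈ D.powerset, R A := by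
            gcongr
            · norm_num
            · exact hB.card_le D hD
        _ = _ := by
            rw [Finset.mul_sum]
            refine Finset.sum_congr rfl fun A hA => ?_
            rw [hsub A hA, hsub (D \ A) (Finset.mem_powerset.2 Finset.sdiff_subset), one_mul,
              mul_one]
    · refine le_of_eq_of_le (Finset.sum_eq_zero fun ξ hξ => Finset.sum_eq_zero fun x hx => ?_)
        zero_le
      simp only [h]
      rw [Finset.insert_erase (mem_part.1 hx),
        Finset.union_sdiff_of_subset (Finset.mem_powerset.1 hξ)]
      simp [b, hD]
  refine step1.trans_lt (ENNReal.mul_lt_top ENNReal.ofReal_lt_top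
    (step2.trans_lt (ENNReal.mul_lt_top (by finiteness) ?_)))
  rw [lintegral_prod_mul (f := fun D => b D * R D) (hb.mul hR).aemeasurable hb.aemeasurable]
  refine ENNReal.mul_lt_top ?_ ?_
  · have : (fun D => b D * R D) = B.indicator R := by
      ext D
      by_cases hD : D ∈ B <;> simp [b, hD]
    rw [this, lintegral_indicator hB.measurableSet]
    exact hB.rate_lt_top
  · rw [lintegral_indicator_one hB.measurableSet]
    exact hB.measure_lt_top

/-! ### The operator `K⁻¹ L K` in terms of the kernels -/

theorem mk_notMem_of_notMem {s : Bool} {y : E d} {D : Marked d}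
    (h : y ∉ D.toLeft ∪ D.toRight) : mk s y ∉ D := by
  rw [Finset.mem_union, not_or] at h
  cases s
  · simpa [mk] using h.2
  · simpa [mk] using h.1

theorem disjoint_insert_mk {s : Bool} {y : E d} {D : Marked d}
    (hD : Disjoint D.toLeft D.toRight) (h : y ∉ D.toLeft ∪ D.toRight) :
    Disjoint (insert (mk s y) D).toLeft (insert (mk s y) D).toRight := by
  rw [Finset.mem_union, not_or] at h
  cases s
  · simpa [mk, -Finset.mem_toLeft, -Finset.mem_toRight] using ⟨h.1, hD⟩
  · simpa [mk, -Finset.mem_toLeft, -Finset.mem_toRight] using ⟨h.2, hD⟩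

theorem disjoint_of_subset {A D : Marked d} (hD : Disjoint D.toLeft D.toRight) (h : A ⊆ D) :
    Disjoint A.toLeft A.toRight :=
  Finset.disjoint_of_subset_left (Finset.toLeft_subset_toLeft h)
    (Finset.disjoint_of_subset_right (Finset.toRight_subset_toRight h) hD)

theorem ae_notMem_finset (hd : 0 < d) (S : Finset (E d)) : ∀ᵐ y : E d, y ∉ S := by
  have := nontrivial_E hd
  rw [ae_iff]
  simpa using S.finite_toSet.measure_zero volume

/-- The subsets of D∖x are common to both configurations and cancel; those containing the hopping
point are matched by their remainder Z. The condition on y keeps the new position off all occupied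
ones, so neither transform is cut off and y is really new. -/
theorem markedKT_insert_sub {s t : Bool} {x y : E d} {D : Marked d} {g : Marked d → ℝ}
    (hD : Disjoint D.toLeft D.toRight) (hx : mk s x ∈ D) (hy : y ∉ D.toLeft ∪ D.toRight) :
    markedKT g (insert (mk t y) (D.erase (mk s x))) - markedKT g D =
      ∑ Z ∈ (D.erase (mk s x)).powerset, (g (insert (mk t y) Z) - g (insert (mk s x) Z)) := by
  have h1 : Disjoint (insert (mk t y) (D.erase (mk s x))).toLeft
      (insert (mk t y) (D.erase (mk s x))).toRight :=
    disjoint_of_subset (disjoint_insert_mk (s := t) hD hy)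
      (Finset.insert_subset_insert _ (Finset.erase_subset _ _))
  have h2 : mk t y ∉ D.erase (mk s x) := fun h =>
    mk_notMem_of_notMem hy (Finset.mem_of_mem_erase h)
  rw [markedKT, markedKT, if_pos h1, if_pos hD, Finset.sum_powerset_insert h2]
  conv_lhs => rw [← Finset.insert_erase hx, Finset.sum_powerset_insert (Finset.notMem_erase _ _),
    Finset.insert_erase hx]
  rw [Finset.sum_sub_distrib]
  ring

/-- The sum over a chain `ξ ⊆ D ⊆ η` with a distinguished point of `ξ`, in two orders. -/
theorem sum_chain_comm {s : Bool} (η : Marked d) (J : E d → Marked d → Marked d → ℝ) :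
    ∑ D ∈ η.powerset, (-1 : ℝ) ^ (η \ D).card * ∑ x ∈ part s D,
        ∑ Z ∈ (D.erase (mk s x)).powerset, J x (D.erase (mk s x)) Z =
      ∑ ξ ∈ η.powerset, ∑ x ∈ part s ξ, ∑ A ∈ (η \ ξ).powerset,
        (-1 : ℝ) ^ ((η \ ξ) \ A).card * J x (A ∪ ξ.erase (mk s x)) (ξ.erase (mk s x)) := by
  simp only [Finset.mul_sum]
  simp only [Finset.sum_sigma']
  -- The bijection takes (D, x, Z) to ξ = Z ∪ x, the same x, and A = D∖ξ; its inverse recovers D = A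
  -- ∪ ξ and Z = ξ∖x.
  refine Finset.sum_nbij'
    (fun i => ⟨insert (mk s i.2.1) i.2.2, i.2.1, i.1 \ insert (mk s i.2.1) i.2.2⟩)
    (fun i => ⟨i.2.2 ∪ i.1, i.2.1, i.1.erase (mk s i.2.1)⟩) ?_ ?_ ?_ ?_ ?_
  · rintro ⟨D, x, Z⟩ h
    simp only [Finset.mem_sigma, Finset.mem_powerset, mem_part] at h ⊢
    obtain ⟨h1, h2, h3⟩ := h
    refine ⟨Finset.insert_subset (h1 h2) (h3.trans ((Finset.erase_subset _ _).trans h1)),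
      Finset.mem_insert_self _ _, Finset.sdiff_subset_sdiff h1 subset_rfl⟩
  · rintro ⟨ξ, x, A⟩ h
    simp only [Finset.mem_sigma, Finset.mem_powerset, mem_part] at h ⊢
    obtain ⟨h1, h2, h3⟩ := h
    refine ⟨Finset.union_subset (h3.trans Finset.sdiff_subset) h1, Finset.mem_union_right _ h2,
      Finset.erase_subset_erase _ Finset.subset_union_right⟩
  · rintro ⟨D, x, Z⟩ h
    simp only [Finset.mem_sigma, Finset.mem_powerset, mem_part] at h
    obtain ⟨h1, h2, h3⟩ := h
    have hZ : mk s x ∉ Z := fun h => Finset.notMem_erase _ _ (h3 h)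
    have hi : insert (mk s x) Z ⊆ D :=
      Finset.insert_subset h2 (h3.trans (Finset.erase_subset _ _))
    simp only [Finset.sdiff_union_of_subset hi, Finset.erase_insert hZ]
  · rintro ⟨ξ, x, A⟩ h
    simp only [Finset.mem_sigma, Finset.mem_powerset, mem_part] at h
    obtain ⟨h1, h2, h3⟩ := h
    have hA : Disjoint A ξ := Finset.disjoint_of_subset_left h3 Finset.sdiff_disjoint
    simp only [Finset.insert_erase h2, Finset.union_sdiff_cancel_right hA]
  · rintro ⟨D, x, Z⟩ h
    simp only [Finset.mem_sigma, Finset.mem_powerset, mem_part] at h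
    obtain ⟨h1, h2, h3⟩ := h
    have hZ : mk s x ∉ Z := fun h => Finset.notMem_erase _ _ (h3 h)
    have hi : insert (mk s x) Z ⊆ D :=
      Finset.insert_subset h2 (h3.trans (Finset.erase_subset _ _))
    simp only [Finset.erase_insert hZ]
    congr 3
    · rw [sdiff_sdiff_left, Finset.sup_eq_union, Finset.union_sdiff_of_subset hi]
    · ext p
      have := @h3 p
      simp only [Finset.mem_erase, Finset.mem_union, Finset.mem_sdiff, Finset.mem_insert] at this ⊢
      tauto

/-- The increment of Kg depends on D only through the range of Z. Once the chain ξ = Z∪x ⊂ D ⊂ η is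
summed over D first, the signs act on the rates alone and form the kernel. Integrability of the
rates allows the finite sums to pass through the integral. -/
theorem hopHat_eq (hd : 0 < d) {s t : Bool} {c : E d → E d → Marked d → ℝ}
    {g : Marked d → ℝ} (hg : Measurable g) {M : ℝ} (hM : ∀ D, |g D| ≤ M) {η : Marked d}
    (hη : Disjoint η.toLeft η.toRight)
    (hi : ∀ D ∈ η.powerset, ∀ x ∈ part s D, Integrable fun y => c x y (D.erase (mk s x))) :
    hopHat s t c g η = ∑ ξ ∈ η.powerset, ∑ x ∈ part s ξ,
      ∫ y, kern c x y (ξ.erase (mk s x)) (η \ ξ) *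
        (g (insert (mk t y) (ξ.erase (mk s x))) - g ξ) := by
  let J : E d → Marked d → Marked d → ℝ := fun x D Z =>
    ∫ y, c x y D * (g (insert (mk t y) Z) - g (insert (mk s x) Z))
  have hint : ∀ x D Z, (Integrable fun y => c x y D) →
      Integrable fun y => c x y D * (g (insert (mk t y) Z) - g (insert (mk s x) Z)) := by
    intro x D Z h
    refine h.mul_bdd (c := M + M) ?_ (Filter.Eventually.of_forall fun y => ?_)
    · exact ((hg.comp (measurable_id.marked_insert t measurable_const)).sub
        measurable_const).aestronglyMeasurable
    · exact (norm_sub_le _ _).trans (add_le_add (hM _) (hM _))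
  have h1 : ∀ D ∈ η.powerset, hop s t c (markedKT g) D =
      ∑ x ∈ part s D, ∑ Z ∈ (D.erase (mk s x)).powerset, J x (D.erase (mk s x)) Z := by
    intro D hD
    refine Finset.sum_congr rfl fun x hx => ?_
    simp only [J]
    rw [← integral_finsetSum _ fun Z _ => hint _ _ _ (hi D hD x hx)]
    refine integral_congr_ae ?_
    filter_upwards [ae_notMem_finset hd (D.toLeft ∪ D.toRight)] with y hy
    rw [markedKT_insert_sub (disjoint_of_subset hη (Finset.mem_powerset.1 hD)) (mem_part.1 hx) hy,
      Finset.mul_sum]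
  rw [hopHat, Finset.sum_congr rfl fun D hD => by rw [h1 D hD], sum_chain_comm]
  refine Finset.sum_congr rfl fun ξ hξ => Finset.sum_congr rfl fun x hx => ?_
  have hx' := mem_part.1 hx
  -- This is the hypothesis for D = A ∪ ξ: as x ∉ A, removing x from D gives A ∪ (ξ∖x).
  have hi' : ∀ A ∈ (η \ ξ).powerset, Integrable fun y => c x y (A ∪ ξ.erase (mk s x)) := by
    intro A hA
    have hA' := Finset.mem_powerset.1 hA
    have h := hi (A ∪ ξ) (Finset.mem_powerset.2 (Finset.union_subset
      (hA'.trans Finset.sdiff_subset) (Finset.mem_powerset.1 hξ))) x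
      (mem_part.2 (Finset.mem_union_right _ hx'))
    have hxA : mk s x ∉ A := fun h => (Finset.mem_sdiff.1 (hA' h)).2 hx'
    rwa [Finset.erase_union_distrib, Finset.erase_eq_of_notMem hxA] at h
  simp only [kern, Finset.sum_mul, J, Finset.insert_erase hx']
  rw [integral_finsetSum]
  · refine Finset.sum_congr rfl fun A _ => ?_
    rw [← integral_const_mul]
    simp only [mul_assoc]
  · intro A hA
    have := hint x _ (ξ.erase (mk s x)) (hi' A hA)
    rw [Finset.insert_erase hx'] at this
    simpa only [mul_assoc] using this.const_mul _

/-! ### Duality -/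

section duality

variable {s t : Bool} {c : E d → E d → Marked d → ℝ} {B : Set (Marked d)} {N : ℕ}
  {k : Marked d → ℝ} {M : ℝ}

/-- A finite integral forces finite rates at almost every D ∈ B. The splitting formula extends this
to all subsets of almost every η ∈ B at once. -/
theorem ae_integrable_rate (hd : 0 < d) (hc : IsMarkedRate c) (hB : IsCutoff s c B N) :
    ∀ᵐ η ∂markedLP d, η ∈ B → ∀ D ∈ η.powerset, ∀ x ∈ part s D,
      Integrable fun y => c x y (D.erase (mk s x)) := by
  have h1 : ∀ᵐ D ∂markedLP d, D ∈ B → ∀ x ∈ part s D,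
      Integrable fun y => c x y (D.erase (mk s x)) := by
    rw [← ae_restrict_iff' hB.measurableSet]
    have hm : Measurable fun D : Marked d =>
        ∑ x ∈ part s D, ∫⁻ y, ENNReal.ofReal (c x y (D.erase (mk s x))) :=
      (sumTransfer_part hd s).measurable_ennreal
        (fun q => ∫⁻ y, ENNReal.ofReal (c q.2 y q.1))
        (hc.measurable_lintegral measurable_snd measurable_fst)
    filter_upwards [ae_lt_top hm hB.rate_lt_top.ne] with D hD x hx
    refine ⟨(hc.measurable_comp measurable_const measurable_id
      measurable_const).aestronglyMeasurable, ?_⟩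
    rw [hasFiniteIntegral_iff_ofReal (Filter.Eventually.of_forall fun y => hc.nonneg _ _ _)]
    exact ENNReal.sum_lt_top.1 hD x hx
  have h2 := (sumTransfer_powerset hd).ae (Measure.quasiMeasurePreserving_fst.ae h1)
  filter_upwards [h2] with η hη hηB D hD
  exact hη D hD (hB.mem_of_subset η hηB D (Finset.mem_powerset.1 hD))

/-- In the gain term the arrival point y belongs to η while the departure point x is integrated out,
so x and y have to trade places before the Mecke formula can form η = ξ∪y. -/
theorem measurePreserving_exchange :
    MeasurePreserving (fun p : (Marked d × E d) × (Marked d × E d) =>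
      ((p.1.1, p.2.2), (p.2.1, p.1.2)))
      (((markedLP d).prod volume).prod ((markedLP d).prod volume))
      (((markedLP d).prod volume).prod ((markedLP d).prod volume)) := by
  have h1 := (MeasurePreserving.id ((markedLP d).prod (volume : Measure (E d)))).prod
    (Measure.measurePreserving_swap (μ := markedLP d) (ν := (volume : Measure (E d))))
  have h2 := measurePreserving_prodProdProdComm (markedLP d) (volume : Measure (E d))
    (volume : Measure (E d)) (markedLP d)
  have h3 := (MeasurePreserving.id ((markedLP d).prod (volume : Measure (E d)))).prod
    (Measure.measurePreserving_swap (μ := (volume : Measure (E d))) (ν := markedLP d))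
  exact h3.comp (h2.comp h1)

/-- The two expressions can differ only if ζ contains the removed marked point, or if the added one
coincides with it; both are null events. -/
theorem ae_dual_arg (hd : 0 < d) {η : Marked d} (y : E d) :
    ∀ᵐ q ∂(markedLP d).prod (volume : Measure (E d)), (q.1 ∪ η ∪ {mk s q.2}) \ {mk t y} =
      insert (mk s q.2) (η.erase (mk t y)) ∪ q.1 := by
  filter_upwards [Measure.quasiMeasurePreserving_fst.ae (ae_mk_notMem hd (mk t y)),
    Measure.quasiMeasurePreserving_snd.ae (ae_notMem_finset hd {y})] with q hζ hx
  have hne : mk s q.2 ≠ mk t y := by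
    have hx' : q.2 ≠ y := by simpa using hx
    cases s <;> cases t <;> simp [mk, hx']
  ext p
  simp only [Finset.mem_sdiff, Finset.mem_union, Finset.mem_singleton, Finset.mem_insert,
    Finset.mem_erase]
  constructor
  · tauto
  · rintro ((rfl | h) | h)
    · tauto
    · tauto
    · exact ⟨Or.inl (Or.inl h), fun hp => hζ (hp ▸ h)⟩

/-- All integrals in the expression for the dual of a hop operator converge absolutely. -/
def HopDualConverges (s t : Bool) (c : E d → E d → Marked d → ℝ) (k : Marked d → ℝ)
    (η : Marked d) : Prop :=
  (∀ y ∈ part t η, Integrable (fun q : Marked d × E d =>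
    k ((q.1 ∪ η ∪ {mk s q.2}) \ {mk t y}) * kern c q.2 y (η.erase (mk t y)) q.1)
    ((markedLP d).prod volume)) ∧
  ∀ x ∈ part s η, Integrable (fun q : Marked d × E d =>
    k (q.1 ∪ η) * kern c x q.2 (η.erase (mk s x)) q.1) ((markedLP d).prod volume)

theorem integrable_exchange {F : (Marked d × E d) × (Marked d × E d) → ℝ}
    (hF : Integrable F (((markedLP d).prod volume).prod ((markedLP d).prod volume))) :
    Integrable (fun p : (Marked d × E d) × (Marked d × E d) => F ((p.1.1, p.2.2), (p.2.1, p.1.2)))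
      (((markedLP d).prod volume).prod ((markedLP d).prod volume)) :=
  measurePreserving_exchange.integrable_comp_of_integrable hF

/-- Fubini makes almost every section of Ψ integrable, with (ξ, x) fixed or, after the exchange,
with (ξ, y) fixed. The Mecke formula carries this to all points of almost every η. -/
theorem ae_hopDualConverges (hd : 0 < d)
    (hΨ : Integrable (dualIntegrand s c k)
      (((markedLP d).prod volume).prod ((markedLP d).prod volume))) :
    ∀ᵐ η ∂markedLP d, HopDualConverges s t c k η := by
  have h1 := (sumTransfer_part hd s).ae hΨ.prod_right_ae
  have h2 := (sumTransfer_part hd t).ae (integrable_exchange hΨ).prod_right_ae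
  filter_upwards [h1, h2] with η h1 h2
  refine ⟨fun y hy => (h2 y hy).congr ?_, fun x hx => (h1 x hx).congr ?_⟩
  · filter_upwards [ae_dual_arg (s := s) (t := t) (η := η) hd y] with q hq
    rw [hq]
    rfl
  · refine Filter.Eventually.of_forall fun q => ?_
    simp only [dualIntegrand]
    rw [Finset.insert_erase (mem_part.1 hx), Finset.union_comm]

theorem hopDual_eq (hd : 0 < d) {η : Marked d} (h : HopDualConverges s t c k η) :
    hopDual s t c k η =
      (∑ y ∈ part t η, ∫ q : Marked d × E d,
        dualIntegrand s c k ((η.erase (mk t y), q.2), (q.1, y)) ∂(markedLP d).prod volume) -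
      ∑ x ∈ part s η, ∫ q : Marked d × E d,
        dualIntegrand s c k ((η.erase (mk s x), x), q) ∂(markedLP d).prod volume := by
  rw [hopDual]
  congr 1
  · refine Finset.sum_congr rfl fun y hy => ?_
    rw [← integral_prod _ (h.1 y hy)]
    refine integral_congr_ae ?_
    filter_upwards [ae_dual_arg (s := s) (t := t) (η := η) hd y] with q hq
    rw [hq]
    rfl
  · refine Finset.sum_congr rfl fun x hx => ?_
    simp only [← integral_const_mul]
    rw [← integral_prod _ (h.2 x hx)]
    refine integral_congr_ae (Filter.Eventually.of_forall fun q => ?_)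
    simp only [dualIntegrand]
    rw [Finset.insert_erase (mem_part.1 hx), Finset.union_comm]

/-- Both pairings equal ∫ Φt − ∫ Φs, where Ψ is weighted by g after the hop in Φt and by g before
the hop in Φs. Boundedness of g keeps both weighted functions integrable. -/
theorem hopHat_duality (hd : 0 < d) (hc : IsMarkedRate c) (hB : IsCutoff s c B N)
    (hk : Measurable k) (hM : ∀ D, |k D| ≤ M) (h0 : ∀ D, D ∉ B → k D = 0)
    (hgood : ∀ D, k D ≠ 0 → Disjoint D.toLeft D.toRight)
    {g : Marked d → ℝ} (hg : Measurable g) {M' : ℝ} (hM' : ∀ D, |g D| ≤ M') :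
    Integrable (fun η => hopHat s t c g η * k η) (markedLP d) ∧
    Integrable (fun η => g η * hopDual s t c k η) (markedLP d) ∧
    ∫ η, hopHat s t c g η * k η ∂markedLP d = ∫ η, g η * hopDual s t c k η ∂markedLP d := by
  have hΨ := integrable_dualIntegrand hd hc hB hk hM h0
  have hΨm := measurable_dualIntegrand s hc hk
  have hgm : ∀ (u : Bool) {α : Type} [MeasurableSpace α] {x : α → E d} {D : α → Marked d},
      Measurable x → Measurable D → Measurable fun a => g (insert (mk u (x a)) (D a)) :=
    fun u _ _ _ _ hx hD => hg.comp (hx.marked_insert u hD)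
  let Φt : (Marked d × E d) × (Marked d × E d) → ℝ := fun p =>
    dualIntegrand s c k p * g (insert (mk t p.2.2) p.1.1)
  let Φs : (Marked d × E d) × (Marked d × E d) → ℝ := fun p =>
    dualIntegrand s c k p * g (insert (mk s p.1.2) p.1.1)
  have mt : Measurable Φt := hΨm.mul (hgm t (by fun_prop) (by fun_prop))
  have ms : Measurable Φs := hΨm.mul (hgm s (by fun_prop) (by fun_prop))
  have it : Integrable Φt (((markedLP d).prod volume).prod ((markedLP d).prod volume)) :=
    hΨ.mul_bdd (hgm t (by fun_prop) (by fun_prop)).aestronglyMeasurable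
      (Filter.Eventually.of_forall fun p => hM' _)
  have is : Integrable Φs (((markedLP d).prod volume).prod ((markedLP d).prod volume)) :=
    hΨ.mul_bdd (hgm s (by fun_prop) (by fun_prop)).aestronglyMeasurable
      (Filter.Eventually.of_forall fun p => hM' _)
  -- the left-hand side
  have hassoc := measurePreserving_prodAssoc ((markedLP d).prod (volume : Measure (E d)))
    (markedLP d) (volume : Measure (E d))
  let F : (Marked d × E d) × Marked d → ℝ := fun q => ∫ y, (Φt - Φs) (q.1, (q.2, y))
  have hFm : Measurable F := by
    have h : Measurable fun p : ((Marked d × E d) × Marked d) × E d =>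
        (Φt - Φs) (p.1.1, (p.1.2, p.2)) := (mt.sub ms).comp (by fun_prop)
    exact h.stronglyMeasurable.integral_prod_right'.measurable
  have hiA : Integrable (fun p : ((Marked d × E d) × Marked d) × E d =>
      (Φt - Φs) (p.1.1, (p.1.2, p.2)))
      ((((markedLP d).prod volume).prod (markedLP d)).prod volume) :=
    hassoc.integrable_comp_of_integrable (it.sub is)
  have hFi : Integrable F (((markedLP d).prod volume).prod (markedLP d)) := hiA.integral_prod_left
  have hFint : ∫ q, F q ∂((markedLP d).prod volume).prod (markedLP d) =
      (∫ p, Φt p ∂((markedLP d).prod volume).prod ((markedLP d).prod volume)) -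
      ∫ p, Φs p ∂((markedLP d).prod volume).prod ((markedLP d).prod volume) := by
    rw [← integral_sub it is, ← integral_prod _ hiA]
    exact hassoc.integral_comp MeasurableEquiv.prodAssoc.measurableEmbedding (Φt - Φs)
  have hL : ∀ᵐ η ∂markedLP d, hopHat s t c g η * k η =
      ∑ i ∈ η.powerset.sigma fun ξ => part s ξ,
        F ((i.1.erase (mk s i.2), i.2), η \ i.1) := by
    filter_upwards [ae_integrable_rate hd hc hB] with η hη
    have hF : ∀ ξ ∈ η.powerset, ∀ x ∈ part s ξ, F ((ξ.erase (mk s x), x), η \ ξ) =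
        (∫ y, kern c x y (ξ.erase (mk s x)) (η \ ξ) *
          (g (insert (mk t y) (ξ.erase (mk s x))) - g ξ)) * k η := by
      intro ξ hξ x hx
      simp only [F, Φt, Φs, Pi.sub_apply, dualIntegrand]
      rw [Finset.insert_erase (mem_part.1 hx),
        Finset.union_sdiff_of_subset (Finset.mem_powerset.1 hξ), ← integral_mul_const]
      refine integral_congr_ae (Filter.Eventually.of_forall fun y => ?_)
      simp only
      ring
    rw [Finset.sum_sigma]
    simp only
    rw [Finset.sum_congr rfl fun ξ hξ => Finset.sum_congr rfl fun x hx => hF ξ hξ x hx]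
    by_cases hkη : k η = 0
    · simp [hkη]
    -- Where k does not vanish, η lies in B and has disjoint components, which is what the kernel
    -- formula for `hopHat` requires.
    · have hηB : η ∈ B := by
        by_contra h
        exact hkη (h0 η h)
      rw [hopHat_eq hd hg hM' (hgood η hkη) (hη hηB)]
      simp only [Finset.sum_mul]
  -- the right-hand side
  let Gt : Marked d × E d → ℝ := fun q => ∫ r : Marked d × E d,
    Φt ((q.1, r.2), (r.1, q.2)) ∂(markedLP d).prod volume
  let Gs : Marked d × E d → ℝ := fun q => ∫ r, Φs (q, r) ∂(markedLP d).prod volume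
  have hGtm : Measurable Gt := by
    have h : Measurable fun p : (Marked d × E d) × (Marked d × E d) =>
        Φt ((p.1.1, p.2.2), (p.2.1, p.1.2)) := mt.comp (by fun_prop)
    exact h.stronglyMeasurable.integral_prod_right'.measurable
  have hGsm : Measurable Gs := ms.stronglyMeasurable.integral_prod_right'.measurable
  have hGti : Integrable Gt ((markedLP d).prod volume) :=
    (integrable_exchange it).integral_prod_left
  have hGsi : Integrable Gs ((markedLP d).prod volume) := is.integral_prod_left
  have hGt : ∫ q, Gt q ∂(markedLP d).prod volume =
      ∫ p, Φt p ∂((markedLP d).prod volume).prod ((markedLP d).prod volume) := by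
    rw [← integral_prod _ (integrable_exchange it)]
    have he : MeasurableEmbedding (fun p : (Marked d × E d) × (Marked d × E d) =>
        ((p.1.1, p.2.2), (p.2.1, p.1.2))) :=
      MeasurableEquiv.measurableEmbedding
        { toFun := fun p => ((p.1.1, p.2.2), (p.2.1, p.1.2))
          invFun := fun p => ((p.1.1, p.2.2), (p.2.1, p.1.2))
          left_inv := fun _ => rfl
          right_inv := fun _ => rfl
          measurable_toFun := by
            simp only [Equiv.coe_fn_mk]
            fun_prop
          measurable_invFun := by
            simp only [Equiv.coe_fn_symm_mk]
            fun_prop }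
    exact measurePreserving_exchange.integral_comp he Φt
  have hGs : ∫ q, Gs q ∂(markedLP d).prod volume =
      ∫ p, Φs p ∂((markedLP d).prod volume).prod ((markedLP d).prod volume) :=
    (integral_prod _ is).symm
  have hR : ∀ᵐ η ∂markedLP d, g η * hopDual s t c k η =
      ∑ y ∈ part t η, Gt (η.erase (mk t y), y) - ∑ x ∈ part s η, Gs (η.erase (mk s x), x) := by
    filter_upwards [ae_hopDualConverges hd hΨ (t := t)] with η hη
    rw [hopDual_eq hd hη, mul_sub, Finset.mul_sum, Finset.mul_sum]
    congr 1
    · refine Finset.sum_congr rfl fun y hy => ?_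
      simp only [Gt, Φt]
      rw [Finset.insert_erase (mem_part.1 hy), integral_mul_const, mul_comm]
    · refine Finset.sum_congr rfl fun x hx => ?_
      simp only [Gs, Φs]
      rw [Finset.insert_erase (mem_part.1 hx), integral_mul_const, mul_comm]
  have hP := sumTransfer_pointed hd s
  have hT := sumTransfer_part hd t
  have hS := sumTransfer_part hd s
  refine ⟨(hP.integrable hFm hFi).congr (hL.mono fun η h => h.symm),
    ((hT.integrable hGtm hGti).sub (hS.integrable hGsm hGsi)).congr
      (hR.mono fun η h => h.symm), ?_⟩
  rw [integral_congr_ae hL, hP.integral_eq hFm hFi, hFint, integral_congr_ae hR,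
    integral_sub (hT.integrable hGtm hGti) (hS.integrable hGsm hGsi),
    hT.integral_eq hGtm hGti, hS.integral_eq hGsm hGsi, hGt, hGs]

end duality

/-! ### Pairs of disjoint configurations as sets of marked points -/

/-- The set of marked points that corresponds to a pair of configurations. -/
def toMarked (η : Conf2 d) : Marked d := η.pos.disjSum η.neg

/-- The extension by zero of a function on `Γ₀²` to sets of marked points. -/
def markedExt (F : Conf2 d → ℝ) (D : Marked d) : ℝ := ev F D.toLeft D.toRight

@[simp] theorem toLeft_toMarked (η : Conf2 d) : (toMarked η).toLeft = η.pos := by simp [toMarked]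

@[simp] theorem toRight_toMarked (η : Conf2 d) : (toMarked η).toRight = η.neg := by simp [toMarked]

theorem disjoint_toMarked (η : Conf2 d) :
    Disjoint (toMarked η).toLeft (toMarked η).toRight := by
  simpa using η.2

@[simp] theorem markedExt_toMarked (F : Conf2 d → ℝ) (η : Conf2 d) :
    markedExt F (toMarked η) = F η := by
  rw [markedExt, ev, dif_pos (disjoint_toMarked η)]
  congr 1
  ext1
  simp

theorem markedExt_of_not_disjoint (F : Conf2 d → ℝ) {D : Marked d}
    (hD : ¬ Disjoint D.toLeft D.toRight) : markedExt F D = 0 := by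
  rw [markedExt, ev, dif_neg hD]

theorem exists_toMarked_eq {D : Marked d} (hD : Disjoint D.toLeft D.toRight) :
    ∃ η : Conf2 d, toMarked η = D :=
  ⟨⟨(⟨D.toLeft⟩, ⟨D.toRight⟩), hD⟩, Finset.toLeft_disjSum_toRight⟩

theorem ev_eq_markedExt (F : Conf2 d → ℝ) {A B : Finset (E d)} (D : Marked d)
    (hA : D.toLeft = A) (hB : D.toRight = B) : ev F A B = markedExt F D := by
  rw [markedExt, hA, hB]

theorem measurableEmbedding_join : MeasurableEmbedding (join : Conf d × Conf d → Marked d) :=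
  MeasurableEquiv.measurableEmbedding
    { toFun := join
      invFun := split
      left_inv := split_join
      right_inv := join_split
      measurable_toFun := measurable_join
      measurable_invFun := measurable_split }

theorem measurableEmbedding_toMarked : MeasurableEmbedding (toMarked : Conf2 d → Marked d) :=
  measurableEmbedding_join.comp (MeasurableEmbedding.subtype_coe (measurableSet_disjoint d))

/-- Overlapping pairs are null, so passing to the subtype and then to marked points preserves all
integrals. -/
theorem measurePreserving_toMarked (hd : 0 < d) :
    MeasurePreserving (toMarked : Conf2 d → Marked d) (lebPoisson2 d) (markedLP d) := by
  refine ⟨measurableEmbedding_toMarked.measurable, ?_⟩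
  have h : (toMarked : Conf2 d → Marked d) = join ∘ Subtype.val := rfl
  have h' := map_comap_subtype_coe (measurableSet_disjoint d)
    ((lebPoisson d).prod (lebPoisson d))
  rw [Measure.restrict_eq_self_of_ae_mem
    (s := {p : Conf d × Conf d | Disjoint p.1.pts p.2.pts}) (ae_disjoint hd)] at h'
  rw [h, ← Measure.map_map measurable_join measurable_subtype_coe, lebPoisson2, markedLP]
  exact congrArg (Measure.map join) h'

instance : SFinite (lebPoisson2 d) :=
  sFinite_comap (MeasurableEmbedding.subtype_coe (measurableSet_disjoint d)) _

theorem measurable_markedExt {α : Type*} [MeasurableSpace α] {F : α → Conf2 d → ℝ}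
    (hF : Measurable fun p : α × Conf2 d => F p.1 p.2) :
    Measurable fun p : α × Marked d => markedExt (F p.1) p.2 := by
  have he : MeasurableEmbedding (Prod.map id toMarked : α × Conf2 d → α × Marked d) :=
    MeasurableEmbedding.id.prodMap measurableEmbedding_toMarked
  convert he.measurable_extend hF (measurable_const (a := (0 : ℝ))) using 1
  ext ⟨a, D⟩
  by_cases hD : Disjoint D.toLeft D.toRight
  · obtain ⟨η, rfl⟩ := exists_toMarked_eq hD
    have := he.injective.extend_apply (fun p : α × Conf2 d => F p.1 p.2) (fun _ => 0) (a, η)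
    simp only [Prod.map_apply, id] at this
    simp [this]
  · rw [markedExt_of_not_disjoint _ hD, Function.extend_apply']
    rintro ⟨⟨a', η⟩, h⟩
    have : toMarked η = D := congrArg Prod.snd h
    exact hD (this ▸ disjoint_toMarked η)

theorem IsRate.isMarkedRate {c : E d → E d → Conf2 d → ℝ} (hc : IsRate c) :
    IsMarkedRate fun x y => markedExt (c x y) where
  measurable := by
    have h : Measurable fun p : (E d × E d) × Conf2 d => c p.1.1 p.1.2 p.2 :=
      hc.measurable.comp (f := fun p : (E d × E d) × Conf2 d => (p.1.1, p.1.2, p.2)) (by fun_prop)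
    have h' := measurable_markedExt (F := fun q : E d × E d => c q.1 q.2) h
    exact h'.comp (f := fun p : E d × E d × Marked d => ((p.1, p.2.1), p.2.2)) (by fun_prop)
  nonneg x y D := by
    rw [markedExt, ev]
    split_ifs
    · exact hc.nonneg _ _ _
    · exact le_rfl

/-- In c₂⁻(x, y) the hop starts at y, whereas `hop` expects the starting point as first argument. -/
theorem IsRate.isMarkedRate_flip {c : E d → E d → Conf2 d → ℝ} (hc : IsRate c) :
    IsMarkedRate fun y x => markedExt (c x y) where
  measurable := hc.isMarkedRate.measurable.comp
    (f := fun p : E d × E d × Marked d => (p.2.1, p.1, p.2.2)) (by fun_prop)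
  nonneg x y D := hc.isMarkedRate.nonneg y x D

theorem sum_powerset_toMarked (η : Conf2 d) (f : Marked d → ℝ) :
    ∑ D ∈ (toMarked η).powerset, f D =
      ∑ A ∈ η.pos.powerset, ∑ B ∈ η.neg.powerset, f (A.disjSum B) :=
  sum_powerset_disjSum _ _ _

/-- The cut-off in `markedKT` reproduces the value 0 that `ev` assigns to overlapping components. -/
theorem markedExt_KT (G : Conf2 d → ℝ) : markedExt (KT G) = markedKT (markedExt G) := by
  ext D
  rw [markedKT]
  split_ifs with hD
  · obtain ⟨η, rfl⟩ := exists_toMarked_eq hD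
    rw [markedExt_toMarked, KT, sum_powerset_toMarked]
    simp [markedExt]
  · exact markedExt_of_not_disjoint _ hD

theorem card_disjSum_sdiff (a b A B : Finset (E d)) :
    (a.disjSum b \ A.disjSum B).card = (a \ A).card + (b \ B).card := by
  rw [← Finset.card_disjSum]
  congr 1
  ext (x | x) <;> simp

theorem KInv_eq (F : Conf2 d → ℝ) (η : Conf2 d) :
    KInv F η = ∑ D ∈ (toMarked η).powerset, (-1 : ℝ) ^ (toMarked η \ D).card * markedExt F D := by
  rw [sum_powerset_toMarked]
  simp [KInv, toMarked, card_disjSum_sdiff, markedExt]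

theorem KRate_eq (c : E d → E d → Conf2 d → ℝ) (x y : E d) {ξp ξm : Finset (E d)} (ξ : Marked d)
    (hp : ξ.toLeft = ξp) (hm : ξ.toRight = ξm) (ζ : Conf2 d) :
    KRate c x y ξp ξm ζ.pos ζ.neg = kern (fun x y => markedExt (c x y)) x y ξ (toMarked ζ) := by
  rw [KRate, ev_eq_markedExt _ (toMarked ζ) (by simp) (by simp), markedExt_toMarked, KInv_eq, kern]
  refine Finset.sum_congr rfl fun A hA => ?_
  obtain ⟨α, rfl⟩ := exists_toMarked_eq
    (disjoint_of_subset (disjoint_toMarked ζ) (Finset.mem_powerset.1 hA))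
  rw [markedExt_toMarked, ev_eq_markedExt _ (toMarked α ∪ ξ)]
  · rw [Finset.toLeft_union, toLeft_toMarked, hp]
  · rw [Finset.toRight_union, toRight_toMarked, hm]

theorem L1_eq (cp cm : E d → E d → Conf2 d → ℝ) (F : Conf2 d → ℝ) (η : Conf2 d) :
    L1 cp cm F η =
      hop true true (fun x y => markedExt (cp x y)) (markedExt F) (toMarked η) +
      hop false false (fun x y => markedExt (cm x y)) (markedExt F) (toMarked η) := by
  simp only [L1, hop, part, mk, if_true, Bool.false_eq_true, if_false, toLeft_toMarked,
    toRight_toMarked, markedExt_toMarked]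
  congr 1
  · refine Finset.sum_congr rfl fun x _ => integral_congr_ae (Filter.Eventually.of_forall fun y => ?_)
    simp only
    rw [ev_eq_markedExt (cp x y) ((toMarked η).erase (Sum.inl x)),
      ev_eq_markedExt F (insert (Sum.inl y) ((toMarked η).erase (Sum.inl x)))] <;>
      (ext z; simp [toMarked]; try tauto)
  · refine Finset.sum_congr rfl fun x _ => integral_congr_ae (Filter.Eventually.of_forall fun y => ?_)
    simp only
    rw [ev_eq_markedExt (cm x y) ((toMarked η).erase (Sum.inr x)),
      ev_eq_markedExt F (insert (Sum.inr y) ((toMarked η).erase (Sum.inr x)))] <;>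
      (ext z; simp [toMarked]; try tauto)

theorem L2_eq (cp cm : E d → E d → Conf2 d → ℝ) (F : Conf2 d → ℝ) (η : Conf2 d) :
    L2 cp cm F η =
      hop true false (fun x y => markedExt (cp x y)) (markedExt F) (toMarked η) +
      hop false true (fun y x => markedExt (cm x y)) (markedExt F) (toMarked η) := by
  simp only [L2, hop, part, mk, if_true, Bool.false_eq_true, if_false, toLeft_toMarked,
    toRight_toMarked, markedExt_toMarked]
  congr 1
  · refine Finset.sum_congr rfl fun x _ => integral_congr_ae (Filter.Eventually.of_forall fun y => ?_)
    simp only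
    rw [ev_eq_markedExt (cp x y) ((toMarked η).erase (Sum.inl x)),
      ev_eq_markedExt F (insert (Sum.inr y) ((toMarked η).erase (Sum.inl x)))] <;>
      (ext z; simp [toMarked]; try tauto)
  · refine Finset.sum_congr rfl fun x _ => integral_congr_ae (Filter.Eventually.of_forall fun y => ?_)
    simp only
    rw [ev_eq_markedExt (cm y x) ((toMarked η).erase (Sum.inr x)),
      ev_eq_markedExt F (insert (Sum.inl y) ((toMarked η).erase (Sum.inr x)))] <;>
      (ext z; simp [toMarked]; try tauto)

theorem KInv_add_hop {L : (Conf2 d → ℝ) → Conf2 d → ℝ} {s t s' t' : Bool}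
    {c c' : E d → E d → Marked d → ℝ}
    (hL : ∀ F η, L F η =
      hop s t c (markedExt F) (toMarked η) + hop s' t' c' (markedExt F) (toMarked η))
    (G : Conf2 d → ℝ) (η : Conf2 d) :
    KInv (L (KT G)) η =
      hopHat s t c (markedExt G) (toMarked η) + hopHat s' t' c' (markedExt G) (toMarked η) := by
  rw [KInv_eq, hopHat, hopHat, ← Finset.sum_add_distrib]
  refine Finset.sum_congr rfl fun D hD => ?_
  obtain ⟨α, rfl⟩ := exists_toMarked_eq
    (disjoint_of_subset (disjoint_toMarked η) (Finset.mem_powerset.1 hD))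
  rw [markedExt_toMarked, hL, markedExt_KT, mul_add]

/-! ### The dual image is determined almost everywhere -/

/-- The configurations with at most `N` points of each kind, all of them in `Λ`. -/
def box (Λ : Set (E d)) (N : ℕ) : Set (Marked d) :=
  {D | ((D.toLeft : Set (E d)) ⊆ Λ ∧ D.toLeft.card ≤ N) ∧
    ((D.toRight : Set (E d)) ⊆ Λ ∧ D.toRight.card ≤ N)}

theorem measurableSet_box {Λ : Set (E d)} (hΛ : MeasurableSet Λ) (N : ℕ) :
    MeasurableSet (box Λ N) := by
  have h : MeasurableSet {a : Conf d | (a.pts : Set (E d)) ⊆ Λ ∧ a.pts.card ≤ N} :=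
    (measurableSet_subset hΛ).inter (measurable_card measurableSet_Iic)
  exact (measurable_toLeft h).inter (measurable_toRight h)

theorem isBbs_indicator {A : Set (Conf2 d)} (hA : MeasurableSet A) {Λ : Set (E d)}
    (hΛ : MeasurableSet Λ) (hb : Bornology.IsBounded Λ) {N : ℕ} (h : A ⊆ toMarked ⁻¹' box Λ N) :
    IsBbs (A.indicator 1) where
  measurable := measurable_one.indicator hA
  bounded := ⟨1, fun η => by by_cases hη : η ∈ A <;> simp [hη]⟩
  support := by
    refine ⟨Λ, Λ, N, N, hΛ, hb, hΛ, hb, fun η hη => ?_⟩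
    have hA : η ∈ A := Set.mem_of_indicator_ne_zero hη
    have := h hA
    simp only [box, Set.mem_preimage, Set.mem_ofPred_eq, toLeft_toMarked, toRight_toMarked] at this
    exact ⟨this.1.1, this.1.2, this.2.1, this.2.2⟩

theorem exists_mem_box (D : Marked d) : ∃ N : ℕ, D ∈ box (Metric.ball 0 N) N := by
  have key : ∀ S : Finset (E d), ∃ N : ℕ, ∀ n ≥ N,
      (S : Set (E d)) ⊆ Metric.ball 0 n ∧ S.card ≤ n := by
    intro S
    obtain ⟨r, hr⟩ := S.finite_toSet.isBounded.subset_ball (0 : E d)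
    obtain ⟨n, hn⟩ := exists_nat_gt r
    refine ⟨max n S.card, fun m hm => ⟨hr.trans (Metric.ball_subset_ball ?_),
      (le_max_right _ _).trans hm⟩⟩
    exact hn.le.trans (by exact_mod_cast (le_max_left _ _).trans hm)
  obtain ⟨n, hn⟩ := key D.toLeft
  obtain ⟨m, hm⟩ := key D.toRight
  exact ⟨max n m, hn _ (le_max_left _ _), hm _ (le_max_right _ _)⟩

/-- Indicators of measurable sets inside a bounded box belong to B_bs, so h − f has zero integral
over each such set and vanishes a.e. in the box. Countably many boxes exhaust Γ₀². -/
theorem IsDualImage.iff_ae_eq {T : (Conf2 d → ℝ) → Conf2 d → ℝ} {k f : Conf2 d → ℝ}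
    (hf : IsDualImage T k f) (h : Conf2 d → ℝ) :
    IsDualImage T k h ↔ ∀ᵐ η ∂lebPoisson2 d, h η = f η := by
  constructor
  · intro hh
    have key : ∀ N : ℕ, ∀ᵐ η ∂lebPoisson2 d,
        toMarked η ∈ box (Metric.ball 0 N) N → h η = f η := by
      intro N
      let S : Set (Conf2 d) := toMarked ⁻¹' box (Metric.ball 0 N) N
      have hS : MeasurableSet S :=
        measurableEmbedding_toMarked.measurable (measurableSet_box Metric.isOpen_ball.measurableSet N)
      have hG : ∀ A : Set (Conf2 d), MeasurableSet A → IsBbs ((A ∩ S).indicator 1) := fun A hA =>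
        isBbs_indicator (hA.inter hS) Metric.isOpen_ball.measurableSet Metric.isBounded_ball
          Set.inter_subset_right
      have hi : ∀ A : Set (Conf2 d), MeasurableSet A →
          ∫ η, (A ∩ S).indicator 1 η * h η ∂lebPoisson2 d =
            ∫ η, (A ∩ S).indicator 1 η * f η ∂lebPoisson2 d := fun A hA =>
        (hh _ (hG A hA)).2.2.symm.trans (hf _ (hG A hA)).2.2
      -- Neither h nor f need be integrable on all of Γ₀², and h is not assumed measurable: what is
      -- needed on the box comes from the pairing with its indicator.
      have hu : Integrable (fun η => S.indicator 1 η * (h η - f η)) (lebPoisson2 d) := by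
        have h1 := (hh _ (hG _ MeasurableSet.univ)).2.1
        have h2 := (hf _ (hG _ MeasurableSet.univ)).2.1
        simp only [Set.univ_inter] at h1 h2
        simp only [mul_sub]
        exact h1.sub h2
      have hz := hu.ae_eq_zero_of_forall_setIntegral_eq_zero fun A hA _ => by
        rw [← integral_indicator hA]
        have : A.indicator (fun η => S.indicator 1 η * (h η - f η)) =
            fun η => (A ∩ S).indicator 1 η * h η - (A ∩ S).indicator 1 η * f η := by
          ext η
          by_cases h1 : η ∈ A <;> by_cases h2 : η ∈ S <;> simp [h1, h2]
        rw [this, integral_sub (hh _ (hG A hA)).2.1 (hf _ (hG A hA)).2.1, hi A hA, sub_self]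
      filter_upwards [hz] with η hη hS'
      have hS'' : η ∈ S := hS'
      simp only [hS'', Set.indicator_of_mem, Pi.one_apply, one_mul, Pi.zero_apply] at hη
      linarith
    filter_upwards [ae_all_iff.2 key] with η hη
    obtain ⟨N, hN⟩ := exists_mem_box (toMarked η)
    exact hη N hN
  · intro hh G hG
    have hc : (fun η => G η * f η) =ᵐ[lebPoisson2 d] fun η => G η * h η := by
      filter_upwards [hh] with η hη
      rw [hη]
    exact ⟨(hf G hG).1, (hf G hG).2.1.congr hc, (hf G hG).2.2.trans (integral_congr_ae hc)⟩

/-! ### Dual images of sums of two hop operators -/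

/-- A box is covered by finitely many sets Γ_Λ^(n,m) with n, m ≤ N, so its integrated rate is
bounded by a finite sum of finite ones. Each component has at most N points, hence the size N + N.
-/
theorem isCutoff_box (hd : 0 < d) {s : Bool} {c : E d → E d → Marked d → ℝ} {Λ : Set (E d)}
    (hΛ : MeasurableSet Λ) (hb : Bornology.IsBounded Λ) (N : ℕ)
    (h : ∀ n m, ∫⁻ η in confIn Λ n m, (∑ x ∈ part s (toMarked η),
      ∫⁻ y, ENNReal.ofReal (c x y ((toMarked η).erase (mk s x)))) ∂lebPoisson2 d < ⊤) :
    IsCutoff s c (box Λ N) (N + N) where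
  measurableSet := measurableSet_box hΛ N
  mem_of_subset := by
    rintro D ⟨⟨h1, h2⟩, h3, h4⟩ A hA
    have hl := Finset.toLeft_subset_toLeft hA
    have hr := Finset.toRight_subset_toRight hA
    exact ⟨⟨(Finset.coe_subset.2 hl).trans h1, (Finset.card_le_card hl).trans h2⟩,
      (Finset.coe_subset.2 hr).trans h3, (Finset.card_le_card hr).trans h4⟩
  card_le := by
    rintro D ⟨⟨-, h2⟩, -, h4⟩
    rw [← Finset.card_toLeft_add_card_toRight]
    exact add_le_add h2 h4
  measure_lt_top := by
    rw [markedLP, Measure.map_apply measurable_join (measurableSet_box hΛ N)]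
    have : join ⁻¹' box Λ N = {a : Conf d | (a.pts : Set (E d)) ⊆ Λ ∧ a.pts.card ≤ N} ×ˢ
        {a : Conf d | (a.pts : Set (E d)) ⊆ Λ ∧ a.pts.card ≤ N} := by
      ext p
      simp only [box, join, Set.mem_preimage, Set.mem_ofPred_eq, Finset.toLeft_disjSum,
        Finset.toRight_disjSum, Set.mem_prod]
    rw [this, Measure.prod_prod]
    exact ENNReal.mul_lt_top (lebPoisson_lt_top hΛ hb N) (lebPoisson_lt_top hΛ hb N)
  rate_lt_top := by
    rw [← (measurePreserving_toMarked hd).setLIntegral_comp_preimage_emb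
      measurableEmbedding_toMarked]
    have hsub : toMarked ⁻¹' box Λ N ⊆
        ⋃ i : Fin (N + 1) × Fin (N + 1), confIn (d := d) Λ i.1 i.2 := by
      intro η hη
      simp only [box, Set.mem_preimage, Set.mem_ofPred_eq, toLeft_toMarked, toRight_toMarked] at hη
      exact Set.mem_iUnion.2 ⟨(⟨_, Nat.lt_succ_of_le hη.1.2⟩, ⟨_, Nat.lt_succ_of_le hη.2.2⟩),
        hη.1.1, hη.2.1, rfl, rfl⟩
    refine (lintegral_mono_set hsub).trans_lt ((lintegral_iUnion_le _ _).trans_lt ?_)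
    rw [tsum_fintype]
    exact ENNReal.sum_lt_top.2 fun i _ => h _ _

theorem IsBbs.exists_box {k : Conf2 d → ℝ} (hk : IsBbs k) :
    ∃ (Λ : Set (E d)) (N : ℕ), MeasurableSet Λ ∧ Bornology.IsBounded Λ ∧
      ∀ D, D ∉ box Λ N → markedExt k D = 0 := by
  obtain ⟨Λp, Λm, Np, Nm, h1, h2, h3, h4, h⟩ := hk.support
  refine ⟨Λp ∪ Λm, max Np Nm, h1.union h3, h2.union h4, fun D hD => ?_⟩
  by_contra hne
  have hdis : Disjoint D.toLeft D.toRight := by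
    by_contra hdis
    exact hne (markedExt_of_not_disjoint k hdis)
  obtain ⟨η, rfl⟩ := exists_toMarked_eq hdis
  rw [markedExt_toMarked] at hne
  obtain ⟨a1, a2, a3, a4⟩ := h η hne
  refine hD ⟨⟨?_, ?_⟩, ?_, ?_⟩
  · rw [toLeft_toMarked]
    exact a1.trans Set.subset_union_left
  · rw [toLeft_toMarked]
    exact a2.trans (le_max_left _ _)
  · rw [toRight_toMarked]
    exact a3.trans Set.subset_union_right
  · rw [toRight_toMarked]
    exact a4.trans (le_max_right _ _)

theorem IsBbs.measurable_markedExt {k : Conf2 d → ℝ} (hk : IsBbs k) :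
    Measurable (markedExt k) := by
  have h := TwoComp.measurable_markedExt (α := Unit) (F := fun _ => k)
    (hk.measurable.comp measurable_snd)
  exact h.comp (f := fun D => ((), D)) (by fun_prop)

theorem IsBbs.exists_bound {k : Conf2 d → ℝ} (hk : IsBbs k) :
    ∃ M : ℝ, ∀ D, |markedExt k D| ≤ M := by
  obtain ⟨M, hM⟩ := hk.bounded
  refine ⟨max M 0, fun D => ?_⟩
  by_cases hD : Disjoint D.toLeft D.toRight
  · obtain ⟨η, rfl⟩ := exists_toMarked_eq hD
    rw [markedExt_toMarked]
    exact (hM η).trans (le_max_left _ _)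
  · rw [markedExt_of_not_disjoint k hD, abs_zero]
    exact le_max_right _ _

theorem disjoint_of_markedExt_ne_zero {k : Conf2 d → ℝ} {D : Marked d}
    (h : markedExt k D ≠ 0) : Disjoint D.toLeft D.toRight := by
  by_contra hD
  exact h (markedExt_of_not_disjoint k hD)

section hop

variable {s t : Bool} {c : E d → E d → Marked d → ℝ} {k : Conf2 d → ℝ}

/-- Finiteness of the integrated total rate of hops. -/
def HasFiniteRate (s : Bool) (c : E d → E d → Marked d → ℝ) : Prop :=
  ∀ Λ : Set (E d), MeasurableSet Λ → Bornology.IsBounded Λ → ∀ n m,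
    ∫⁻ η in confIn Λ n m, (∑ x ∈ part s (toMarked η),
      ∫⁻ y, ENNReal.ofReal (c x y ((toMarked η).erase (mk s x)))) ∂lebPoisson2 d < ⊤

theorem ae_hopDualConverges_toMarked (hd : 0 < d) (hc : IsMarkedRate c)
    (h : HasFiniteRate s c) (hk : IsBbs k) :
    ∀ᵐ η ∂lebPoisson2 d, HopDualConverges s t c (markedExt k) (toMarked η) := by
  obtain ⟨Λ, N, hΛ, hb, h0⟩ := hk.exists_box
  obtain ⟨M, hM⟩ := hk.exists_bound
  exact (measurePreserving_toMarked hd).quasiMeasurePreserving.ae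
    (ae_hopDualConverges hd (integrable_dualIntegrand hd hc
      (isCutoff_box hd hΛ hb N (h Λ hΛ hb)) hk.measurable_markedExt hM h0))

theorem hopHat_duality_toMarked (hd : 0 < d) (hc : IsMarkedRate c)
    (h : HasFiniteRate s c) (hk : IsBbs k) {G : Conf2 d → ℝ} (hG : IsBbs G) :
    Integrable (fun η => hopHat s t c (markedExt G) (toMarked η) * k η) (lebPoisson2 d) ∧
    Integrable (fun η => G η * hopDual s t c (markedExt k) (toMarked η)) (lebPoisson2 d) ∧
    ∫ η, hopHat s t c (markedExt G) (toMarked η) * k η ∂lebPoisson2 d =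
      ∫ η, G η * hopDual s t c (markedExt k) (toMarked η) ∂lebPoisson2 d := by
  obtain ⟨Λ, N, hΛ, hb, h0⟩ := hk.exists_box
  obtain ⟨M, hM⟩ := hk.exists_bound
  obtain ⟨M', hM'⟩ := hG.exists_bound
  obtain ⟨h1, h2, h3⟩ := hopHat_duality (t := t) hd hc (isCutoff_box hd hΛ hb N (h Λ hΛ hb))
    hk.measurable_markedExt hM h0 (fun D => disjoint_of_markedExt_ne_zero)
    hG.measurable_markedExt hM'
  have hp := measurePreserving_toMarked hd
  have e1 := hp.integrable_comp_of_integrable h1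
  have e2 := hp.integrable_comp_of_integrable h2
  rw [← hp.integral_comp measurableEmbedding_toMarked,
    ← hp.integral_comp measurableEmbedding_toMarked] at h3
  simp only [Function.comp_def, markedExt_toMarked] at e1 e2 h3
  exact ⟨e1, e2, h3⟩

/-- Both generators are sums of two hop operators, and duality is additive because each pairing
converges separately. -/
theorem isDualImage_add_hop (hd : 0 < d) {s' t' : Bool} {c' : E d → E d → Marked d → ℝ}
    (hc : IsMarkedRate c) (h : HasFiniteRate s c) (hc' : IsMarkedRate c')
    (h' : HasFiniteRate s' c') (hk : IsBbs k) {L : (Conf2 d → ℝ) → Conf2 d → ℝ}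
    (hL : ∀ F η, L F η =
      hop s t c (markedExt F) (toMarked η) + hop s' t' c' (markedExt F) (toMarked η)) :
    IsDualImage (fun G => KInv (L (KT G))) k fun η =>
      hopDual s t c (markedExt k) (toMarked η) + hopDual s' t' c' (markedExt k) (toMarked η) := by
  intro G hG
  obtain ⟨a1, a2, a3⟩ := hopHat_duality_toMarked (t := t) hd hc h hk hG
  obtain ⟨b1, b2, b3⟩ := hopHat_duality_toMarked (t := t') hd hc' h' hk hG
  simp only [KInv_add_hop hL, add_mul, mul_add]
  refine ⟨a1.add b1, a2.add b2, ?_⟩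
  rw [integral_add a1 b1, integral_add a2 b2, a3, b3]

theorem hopDual_toMarked (hd : 0 < d) (K : Marked d → ℝ) (η : Conf2 d) :
    hopDual s t c K (toMarked η) =
      (∑ y ∈ part t (toMarked η), ∫ ζ, ∫ x,
        K ((toMarked ζ ∪ toMarked η ∪ {mk s x}) \ {mk t y}) *
          kern c x y ((toMarked η).erase (mk t y)) (toMarked ζ) ∂volume ∂lebPoisson2 d) -
      ∑ x ∈ part s (toMarked η), ∫ ζ, K (toMarked ζ ∪ toMarked η) *
        ∫ y, kern c x y ((toMarked η).erase (mk s x)) (toMarked ζ) ∂volume ∂lebPoisson2 d := by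
  have hi : ∀ f : Marked d → ℝ, ∫ ζ, f ζ ∂markedLP d = ∫ ζ, f (toMarked ζ) ∂lebPoisson2 d :=
    fun f => ((measurePreserving_toMarked hd).integral_comp measurableEmbedding_toMarked f).symm
  rw [hopDual]
  simp only [hi]

theorem HopDualConverges.left {K : Marked d → ℝ} (hd : 0 < d) {η : Conf2 d}
    (h : HopDualConverges s t c K (toMarked η)) {y : E d} (hy : y ∈ part t (toMarked η)) :
    Integrable (fun q : Conf2 d × E d =>
      K ((toMarked q.1 ∪ toMarked η ∪ {mk s q.2}) \ {mk t y}) *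
        kern c q.2 y ((toMarked η).erase (mk t y)) (toMarked q.1)) ((lebPoisson2 d).prod volume) :=
  ((measurePreserving_toMarked hd).prod
    (MeasurePreserving.id volume)).integrable_comp_of_integrable (h.1 y hy)

theorem HopDualConverges.right {K : Marked d → ℝ} (hd : 0 < d) {η : Conf2 d}
    (h : HopDualConverges s t c K (toMarked η)) {x : E d} (hx : x ∈ part s (toMarked η)) :
    Integrable (fun q : Conf2 d × E d => K (toMarked q.1 ∪ toMarked η) *
      kern c x q.2 ((toMarked η).erase (mk s x)) (toMarked q.1)) ((lebPoisson2 d).prod volume) :=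
  ((measurePreserving_toMarked hd).prod
    (MeasurePreserving.id volume)).integrable_comp_of_integrable (h.2 x hx)

end hop

/-! ### The explicit formulas -/

section formulas

variable (k : Conf2 d → ℝ) (c : E d → E d → Conf2 d → ℝ) (ζ η : Conf2 d) (x y : E d)

theorem part_true_toMarked : part true (toMarked η) = η.pos := toLeft_toMarked η

theorem part_false_toMarked : part false (toMarked η) = η.neg := toRight_toMarked η

theorem ev_union : ev k (ζ.pos ∪ η.pos) (ζ.neg ∪ η.neg) =
    markedExt k (toMarked ζ ∪ toMarked η) := by
  apply ev_eq_markedExt <;> (ext z; simp [toMarked])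

theorem ev_hop_pos_pos : ev k ((ζ.pos ∪ η.pos ∪ {x}) \ {y}) (ζ.neg ∪ η.neg) =
    markedExt k ((toMarked ζ ∪ toMarked η ∪ {mk true x}) \ {mk true y}) := by
  apply ev_eq_markedExt <;> (ext z; simp [toMarked, mk])

theorem ev_hop_neg_neg : ev k (ζ.pos ∪ η.pos) ((ζ.neg ∪ η.neg ∪ {x}) \ {y}) =
    markedExt k ((toMarked ζ ∪ toMarked η ∪ {mk false x}) \ {mk false y}) := by
  apply ev_eq_markedExt <;> (ext z; simp [toMarked, mk])

theorem ev_hop_pos_neg : ev k (ζ.pos ∪ η.pos ∪ {x}) ((ζ.neg ∪ η.neg) \ {y}) =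
    markedExt k ((toMarked ζ ∪ toMarked η ∪ {mk true x}) \ {mk false y}) := by
  apply ev_eq_markedExt <;> (ext z; simp [toMarked, mk])

theorem ev_hop_neg_pos : ev k ((ζ.pos ∪ η.pos) \ {y}) (ζ.neg ∪ η.neg ∪ {x}) =
    markedExt k ((toMarked ζ ∪ toMarked η ∪ {mk false x}) \ {mk true y}) := by
  apply ev_eq_markedExt <;> (ext z; simp [toMarked, mk])

theorem toLeft_erase_pos : ((toMarked η).erase (mk true x)).toLeft = η.pos \ {x} := by
  ext z; simp [toMarked, mk, and_comm]

theorem toRight_erase_pos : ((toMarked η).erase (mk true x)).toRight = η.neg := by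
  ext z; simp [toMarked, mk]

theorem toLeft_erase_neg : ((toMarked η).erase (mk false x)).toLeft = η.pos := by
  ext z; simp [toMarked, mk]

theorem toRight_erase_neg : ((toMarked η).erase (mk false x)).toRight = η.neg \ {x} := by
  ext z; simp [toMarked, mk, and_comm]

theorem KRate_pos (z : E d) : KRate c x y (η.pos \ {z}) η.neg ζ.pos ζ.neg =
    kern (fun x y => markedExt (c x y)) x y ((toMarked η).erase (mk true z)) (toMarked ζ) :=
  KRate_eq c x y _ (toLeft_erase_pos η z) (toRight_erase_pos η z) ζ

theorem KRate_neg (z : E d) : KRate c x y η.pos (η.neg \ {z}) ζ.pos ζ.neg =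
    kern (fun x y => markedExt (c x y)) x y ((toMarked η).erase (mk false z)) (toMarked ζ) :=
  KRate_eq c x y _ (toLeft_erase_neg η z) (toRight_erase_neg η z) ζ

theorem ev_pos_erase : ev k (η.pos \ {x}) η.neg =
    markedExt k ((toMarked η).erase (mk true x)) :=
  ev_eq_markedExt _ _ (toLeft_erase_pos η x) (toRight_erase_pos η x)

theorem ev_neg_erase : ev k η.pos (η.neg \ {x}) =
    markedExt k ((toMarked η).erase (mk false x)) :=
  ev_eq_markedExt _ _ (toLeft_erase_neg η x) (toRight_erase_neg η x)

theorem kern_flip (ξ ζ : Marked d) : kern (fun x y => markedExt (c x y)) x y ξ ζ =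
    kern (fun y x => markedExt (c x y)) y x ξ ζ := rfl

end formulas

/-! ### Identification with the dual hop operators -/

theorem dualFormula1_eq (hd : 0 < d) (cp cm : E d → E d → Conf2 d → ℝ) (k : Conf2 d → ℝ)
    (η : Conf2 d) : dualFormula1 cp cm k η =
      hopDual true true (fun x y => markedExt (cp x y)) (markedExt k) (toMarked η) +
      hopDual false false (fun x y => markedExt (cm x y)) (markedExt k) (toMarked η) := by
  rw [hopDual_toMarked hd, hopDual_toMarked hd, dualFormula1]
  simp only [part_true_toMarked, part_false_toMarked, ev_hop_pos_pos, ev_hop_neg_neg, ev_union,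
    KRate_pos, KRate_neg]
  ring

theorem dualFormula2_eq (hd : 0 < d) (cp cm : E d → E d → Conf2 d → ℝ) (k : Conf2 d → ℝ)
    (η : Conf2 d) : dualFormula2 cp cm k η =
      hopDual true false (fun x y => markedExt (cp x y)) (markedExt k) (toMarked η) +
      hopDual false true (fun y x => markedExt (cm x y)) (markedExt k) (toMarked η) := by
  rw [hopDual_toMarked hd, hopDual_toMarked hd, dualFormula2]
  -- The last term of the formula has k inside the inner integral, while `hopDual` has it outside;
  -- `integral_const_mul` reconciles the two.
  simp only [part_true_toMarked, part_false_toMarked, ev_hop_pos_neg, ev_hop_neg_pos, ev_union,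
    KRate_pos, KRate_neg, kern_flip cm, integral_const_mul]
  ring

theorem converges1_of_hop (hd : 0 < d) {cp cm : E d → E d → Conf2 d → ℝ} {k : Conf2 d → ℝ}
    {η : Conf2 d}
    (h1 : HopDualConverges true true (fun x y => markedExt (cp x y)) (markedExt k) (toMarked η))
    (h2 : HopDualConverges false false (fun x y => markedExt (cm x y)) (markedExt k)
      (toMarked η)) : Converges1 cp cm k η := by
  simp only [Converges1, ev_hop_pos_pos, ev_hop_neg_neg, ev_union, KRate_pos, KRate_neg]
  refine ⟨fun x hx => ?_, fun y hy => ?_⟩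
  · rw [← part_true_toMarked] at hx
    exact ⟨h1.left hd hx, h1.right hd hx⟩
  · rw [← part_false_toMarked] at hy
    exact ⟨h2.left hd hy, h2.right hd hy⟩

theorem converges2_of_hop (hd : 0 < d) {cp cm : E d → E d → Conf2 d → ℝ} {k : Conf2 d → ℝ}
    {η : Conf2 d}
    (h1 : HopDualConverges true false (fun x y => markedExt (cp x y)) (markedExt k) (toMarked η))
    (h2 : HopDualConverges false true (fun y x => markedExt (cm x y)) (markedExt k)
      (toMarked η)) : Converges2 cp cm k η := by
  simp only [Converges2, ev_hop_pos_neg, ev_hop_neg_pos, ev_union, KRate_pos, KRate_neg]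
  refine ⟨fun y hy => ?_, fun x hx => ?_⟩
  · rw [← part_false_toMarked] at hy
    exact ⟨h1.left hd hy, h2.right hd hy⟩
  · rw [← part_true_toMarked] at hx
    exact ⟨h2.left hd hx, h1.right hd hx⟩

theorem hasFiniteRate1 {cp cm : E d → E d → Conf2 d → ℝ}
    (h : ∀ Λ : Set (E d), MeasurableSet Λ → Bornology.IsBounded Λ → ∀ n m : ℕ,
      totalRate1 cp cm Λ m n < ⊤) :
    HasFiniteRate true (fun x y => markedExt (cp x y)) ∧
      HasFiniteRate false (fun x y => markedExt (cm x y)) := by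
  simp only [totalRate1, ev_pos_erase, ev_neg_erase] at h
  refine ⟨fun Λ hΛ hb n m => ?_, fun Λ hΛ hb n m => ?_⟩
  · refine (lintegral_mono fun η => ?_).trans_lt (h Λ hΛ hb n m)
    rw [part_true_toMarked]
    exact le_self_add
  · refine (lintegral_mono fun η => ?_).trans_lt (h Λ hΛ hb n m)
    rw [part_false_toMarked]
    exact le_add_self

theorem hasFiniteRate2 {cp cm : E d → E d → Conf2 d → ℝ}
    (h : ∀ Λ : Set (E d), MeasurableSet Λ → Bornology.IsBounded Λ → ∀ n m : ℕ,
      totalRate2 cp cm Λ m n < ⊤) :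
    HasFiniteRate true (fun x y => markedExt (cp x y)) ∧
      HasFiniteRate false (fun y x => markedExt (cm x y)) := by
  simp only [totalRate2, ev_pos_erase, ev_neg_erase] at h
  refine ⟨fun Λ hΛ hb n m => ?_, fun Λ hΛ hb n m => ?_⟩
  · refine (lintegral_mono fun η => ?_).trans_lt (h Λ hΛ hb n m)
    rw [part_true_toMarked]
    exact le_self_add
  · refine (lintegral_mono fun η => ?_).trans_lt (h Λ hΛ hb n m)
    rw [part_false_toMarked]
    exact le_add_self

end TwoComp

end

/-! ### Existence, uniqueness and explicit form of the dual images -/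

theorem mainTheorem6 {d : ℕ} (hd : 0 < d)
    (c₁p c₁m c₂p c₂m : TwoComp.E d → TwoComp.E d → TwoComp.Conf2 d → ℝ)
    (hc₁p : TwoComp.IsRate c₁p) (hc₁m : TwoComp.IsRate c₁m)
    (hc₂p : TwoComp.IsRate c₂p) (hc₂m : TwoComp.IsRate c₂m)
    (hrate : ∀ (Λ : Set (TwoComp.E d)), MeasurableSet Λ → Bornology.IsBounded Λ → ∀ n m : ℕ,
      TwoComp.totalRate1 c₁p c₁m Λ m n < ⊤ ∧ TwoComp.totalRate2 c₂p c₂m Λ m n < ⊤)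
    (hcond₁ : ∀ (Λ : Set (TwoComp.E d)), MeasurableSet Λ → Bornology.IsBounded Λ → ∀ n m : ℕ,
      TwoComp.bound1 c₁p c₁m Λ m n < ⊤)
    (hcond₂ : ∀ (Λ : Set (TwoComp.E d)), MeasurableSet Λ → Bornology.IsBounded Λ → ∀ n m : ℕ,
      TwoComp.bound2 c₂p c₂m Λ m n < ⊤)
    (k : TwoComp.Conf2 d → ℝ) (hk : TwoComp.IsBbs k) :
    ((∀ᵐ η ∂(TwoComp.lebPoisson2 d), TwoComp.Converges1 c₁p c₁m k η) ∧
      ∀ h : TwoComp.Conf2 d → ℝ, TwoComp.IsDualImage (TwoComp.LHat1 c₁p c₁m) k h ↔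
        ∀ᵐ η ∂(TwoComp.lebPoisson2 d), h η = TwoComp.dualFormula1 c₁p c₁m k η) ∧
    ((∀ᵐ η ∂(TwoComp.lebPoisson2 d), TwoComp.Converges2 c₂p c₂m k η) ∧
      ∀ h : TwoComp.Conf2 d → ℝ, TwoComp.IsDualImage (TwoComp.LHat2 c₂p c₂m) k h ↔
        ∀ᵐ η ∂(TwoComp.lebPoisson2 d), h η = TwoComp.dualFormula2 c₂p c₂m k η) := by
  open TwoComp in
  obtain ⟨r₁p, r₁m⟩ := hasFiniteRate1 fun Λ hΛ hb n m => (hrate Λ hΛ hb n m).1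
  obtain ⟨r₂p, r₂m⟩ := hasFiniteRate2 fun Λ hΛ hb n m => (hrate Λ hΛ hb n m).2
  refine ⟨⟨?_, fun h => ?_⟩, ?_, fun h => ?_⟩
  · filter_upwards [ae_hopDualConverges_toMarked (t := true) hd hc₁p.isMarkedRate r₁p hk,
      ae_hopDualConverges_toMarked (t := false) hd hc₁m.isMarkedRate r₁m hk] with η h1 h2
    exact converges1_of_hop hd h1 h2
  · simp only [dualFormula1_eq hd]
    exact (isDualImage_add_hop hd hc₁p.isMarkedRate r₁p hc₁m.isMarkedRate r₁m hk
      (L1_eq c₁p c₁m)).iff_ae_eq h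
  · filter_upwards [ae_hopDualConverges_toMarked (t := false) hd hc₂p.isMarkedRate r₂p hk,
      ae_hopDualConverges_toMarked (t := true) hd hc₂m.isMarkedRate_flip r₂m hk] with η h1 h2
    exact converges2_of_hop hd h1 h2
  · simp only [dualFormula2_eq hd]
    exact (isDualImage_add_hop hd hc₂p.isMarkedRate r₂p hc₂m.isMarkedRate_flip r₂m hk
      (L2_eq c₂p c₂m)).iff_ae_eq h
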